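/- Let $$H=\begin{pmatrix}1&1&1&1&0&0&0\\0&1&1&0&1&1&0\\0&0&1&1&0&1&1\end{pmatrix},\qquad H'=\begin{pmatrix}1&1&0\\1&1&1\\0&1&0\end{pmatrix}$$ over $\mathbb F_2$; $H=H_x=H_z$ is the parity-check matrix of the Steane code on data qubits $d_1,\dots,d_7$, so that the rows of $H$ are the supports of the three $X$-type and of the three $Z$-type stabilizer generators. For $B\in\{X,Z\}$ and $s\in\mathbb F_2^3$ let $\Pi^B_s=\prod_{i=1}^3\tfrac12\bigl(1+(-1)^{s_i}S^B_i\bigr)$, where $S^B_1,S_2^B,S_3^B$ are the generators of type $B$. **Circuits.** We write $(c,t)$ for a CNOT with control $c$ and target $t$; CNOTs are listed in the order of execution. *Steane-style circuit for the $X$ syndrome* (Goto's flagged preparation of $|0\rangle_L$, then a transversal CNOT): seven ancillas $a_1,\dots,a_7$, of which $a_1,a_5,a_7$ are prepared in $|+\rangle$ and the others in $|0\rangle$, and a flag $\varphi$ prepared in $|0\rangle$; CNOTs $(a_5,a_6),(a_1,a_2),(a_7,a_4),(a_5,a_3),(a_7,a_6),(a_1,a_4),(a_5,a_2),(a_4,a_3)$;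 $(a_6,\varphi),(a_2,\varphi),(a_4,\varphi)$; $(a_1,d_1),\dots,(a_7,d_7)$; then $\varphi$ is measured in the $Z$ basis and $a_1,\dots,a_7$ in the $X$ basis, with outcomes $m\in\mathbb F_2^7$. The syndrome is read out as $s=Hm$. *Optimized circuit for the $X$ syndrome*: three ancillas $a_2,a_3,a_5$ prepared in $|+\rangle$ and a flag $\varphi$ prepared in $|0\rangle$; CNOTs $(a_5,d_6),(a_5,\varphi),(a_3,a_5),(a_3,d_7),(a_2,a_3),(a_2,d_1),(a_3,d_4),(a_3,\varphi),(a_5,a_3),(a_5,a_2),(a_5,d_5),(a_2,\varphi),(a_2,d_2),(a_3,d_3)$; then $\varphi$ is measured in the $Z$ basis and $a_2,a_3,a_5$ in the $X$ basis, with outcomes $b\in\mathbb F_2^3$. The syndrome is read out as $s=H'b$. The circuits for the $Z$ syndrome are the duals: exchange $|0\rangle$ with $|+\rangle$, the $Z$ with the $X$ basis, and the control with the target of each CNOT. **Faults.** Regard a circuit as a ZX diagram, in which a CNOT is a $Z$-spider on the control wire joined by an edge to an $X$-spider on the target wire. The edges are the wire segments and these connecting edges. A *fault* $F$ places a Pauli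 operator $I,X,Y$ or $Z$ on each edge; its *weight* is the number of edges that carry $X$, $Y$ or $Z$. The faulty circuit $C^F$ has, for each outcome $o$ of the syndrome ancillas and $f\in\mathbb F_2$ of the flag, a Kraus operator $K^{C,F}_{o,f}$ on the seven data qubits. The fault $F$ is *detectable* if $K^{C,F}_{o,0}=0$ for all $o$, i.e. if the flag outcome $0$ is impossible. For circuits $C_1,C_2$ with linear readouts $s=R_1o_1$, $s=R_2o_2$, write $C_1^{F_1}=C_2^{F_2}$ if - for all $o_1,o_2,f$ with $R_1o_1=R_2o_2$, the operators $K^{C_1,F_1}_{o_1,f}$ and $K^{C_2,F_2}_{o_2,f}$ are equal up to a nonzero scalar, and - both define the same quantum instrument with outcomes $(s,f)$: $\sum_{R_1o=s}K^{C_1,F_1}_{o,f}\,\rho\,(K^{C_1,F_1}_{o,f})^\dagger=\sum_{R_2o=s}K^{C_2,F_2}_{o,f}\,\rho\,(K^{C_2,F_2}_{o,f})^\dagger$ for all $s$, $f$, $\rho$. The circuits $C_1$ and $C_2$ are *fault-equivalent* if every fault $F_1$ of $C_1$ is detectable or admits a fault $F_2$ of $C_2$ whose weight is at most that of $F_1$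 and with $C_1^{F_1}=C_2^{F_2}$, and the same holds with $C_1$ and $C_2$ exchanged. **Theorem.** For each $B\in\{X,Z\}$, the Steane-style circuit for the $B$ syndrome, with readout $H$, is fault-equivalent to the optimized circuit for the $B$ syndrome, with readout $H'$. The optimized circuit has $14$ CNOTs and $4$ ancillas (three measured ancillas and the flag). Without faults, both circuits have flag outcome $0$ and are non-destructive measurements of the type-$B$ syndrome: each Kraus operator with flag outcome $0$ and read-out syndrome $s$ is a nonzero multiple of $\Pi^B_s$, and the instrument is $\rho\mapsto\Pi^B_s\rho\,\Pi^B_s$. Moreover, $H'$ consists of columns $2,3,5$ of $H$, and $\operatorname{rank}H=\operatorname{rank}H'=3$. -/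

import Mathlib

open scoped Matrix

noncomputable section

namespace SteaneSE

/-! Pauli matrices and single-qubit bases. -/

/-- The single-qubit Pauli operators. -/
inductive Pauli
  | I | X | Y | Z
  deriving DecidableEq

/-- The `2 × 2` matrix of a Pauli operator in the computational basis; entry `(row, column)`. -/
def Pauli.mat : Pauli → Matrix (ZMod 2) (ZMod 2) ℂ
  | .I => Matrix.of fun a b => if a = b then 1 else 0
  | .X => Matrix.of fun a b => if a = b then 0 else 1
  | .Y => Matrix.of fun a b => if a = b then 0 else if a = 0 then -Complex.I else Complex.I
  | .Z => Matrix.of fun a b => if a = b then (if a = 0 then 1 else -1) else 0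

/-- The operator `⨂_q P q` on a register of qubits indexed by `Q`. -/
def pauliString {Q : Type} [Fintype Q] (P : Q → Pauli) :
    Matrix (Q → ZMod 2) (Q → ZMod 2) ℂ :=
  Matrix.of fun y x => ∏ q, (P q).mat (y q) (x q)

/-- The two types of checks (and the corresponding bases). -/
inductive Basis
  | Z | X
  deriving DecidableEq

def Basis.swap : Basis → Basis
  | .Z => .X
  | .X => .Z

/-- The Pauli operator diagonal in the basis. -/
def Basis.pauli : Basis → Pauli
  | .Z => .Z
  | .X => .X

/-- Amplitudes of the basis states: `|0⟩, |1⟩` for `Z`, and `|+⟩, |-⟩` for `X`. -/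
def Basis.ket : Basis → ZMod 2 → ZMod 2 → ℂ
  | .Z, b, x => if x = b then 1 else 0
  | .X, b, x => (if b = 1 ∧ x = 1 then -1 else 1) / (Real.sqrt 2 : ℂ)

/-! Circuits of CNOT gates on seven data qubits, with `m` check ancillas and one flag ancilla. -/

/-- The wires: data qubits, check ancillas, and the flag. -/
inductive Wire (m : ℕ)
  | data (i : Fin 7)
  | anc (j : Fin m)
  | flag
  deriving DecidableEq, Fintype

/-- Amplitudes of a (pure, not necessarily normalized) state of all wires. -/
abbrev State (m : ℕ) : Type := (Wire m → ZMod 2) → ℂ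

/-- Ancillas are prepared in the `+1` eigenstate (outcome `0`) of a basis, then CNOT gates
`(control, target)` are applied in the order of the list, and then the ancillas are measured. -/
structure Circuit (m : ℕ) where
  prepAnc : Fin m → Basis
  prepFlag : Basis
  gates : List (Wire m × Wire m)
  measAnc : Fin m → Basis
  measFlag : Basis

/-- The circuit with the roles of `X` and `Z` exchanged (conjugation by Hadamards on all wires). -/
def Circuit.dual {m : ℕ} (C : Circuit m) : Circuit m where
  prepAnc j := (C.prepAnc j).swap
  prepFlag := C.prepFlag.swap
  gates := C.gates.map Prod.swap
  measAnc j := (C.measAnc j).swap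
  measFlag := C.measFlag.swap

/-! Pauli faults on the edges of the circuit, viewed as a ZX diagram. A CNOT is a `Z`-spider on the
control wire joined by an edge to an `X`-spider on the target wire. -/

/-- The edges that a CNOT adds: the edge joining its two spiders, and the outgoing wire segments of
the control and of the target. -/
inductive Leg
  | link | control | target
  deriving DecidableEq

instance : Fintype Leg where
  elems := {.link, .control, .target}
  complete x := by cases x <;> decide

/-- The edges: the initial segment of each wire, and the three edges added by each CNOT. -/
abbrev Circuit.Edge {m : ℕ} (C : Circuit m) : Type := Wire m ⊕ (Fin C.gates.length × Leg)

/-- A fault places a Pauli operator (possibly the identity) on each edge. -/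
abbrev Circuit.Fault {m : ℕ} (C : Circuit m) : Type := C.Edge → Pauli

/-- The absence of faults. -/
def Circuit.noFault {m : ℕ} (C : Circuit m) : C.Fault := fun _ => Pauli.I

/-- The number of edges that carry `X`, `Y` or `Z`. -/
def Circuit.weight {m : ℕ} (C : Circuit m) (F : C.Fault) : ℕ :=
  (Finset.univ.filter fun e => F e ≠ Pauli.I).card

/-- The Pauli operator `P` on the wire `q`. -/
def applyPauli {m : ℕ} (q : Wire m) (P : Pauli) (ψ : State m) : State m :=
  fun x => ∑ b : ZMod 2, P.mat (x q) b * ψ (Function.update x q b)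

/-- A CNOT with `P` on the edge from its `Z`-spider (on wire `c`) to its `X`-spider (on wire `t`),
that is `∑_{a,b} ⟨b|P|a⟩ (|a⟩⟨a|)_c ⊗ (X^b)_t`. For `P = I` this is the ordinary CNOT gate. -/
def applyCNOT {m : ℕ} (c t : Wire m) (P : Pauli) (ψ : State m) : State m :=
  fun x => ∑ b : ZMod 2, P.mat b (x c) * ψ (Function.update x t (x t + b))

/-- The `i`-th gate, with its faults. -/
def Circuit.step {m : ℕ} (C : Circuit m) (F : C.Fault) (ψ : State m)
    (i : Fin C.gates.length) : State m :=
  let g := C.gates.get i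
  applyPauli g.2 (F (.inr (i, .target)))
    (applyPauli g.1 (F (.inr (i, .control)))
      (applyCNOT g.1 g.2 (F (.inr (i, .link))) ψ))

/-- All gates, with all faults. -/
def Circuit.run {m : ℕ} (C : Circuit m) (F : C.Fault) (ψ : State m) : State m :=
  (List.finRange C.gates.length).foldl (C.step F)
    ((pauliString fun q : Wire m => F (.inl q)) *ᵥ ψ)

/-- Operators on the seven data qubits, in the computational basis. -/
abbrev DataOp : Type := Matrix (Fin 7 → ZMod 2) (Fin 7 → ZMod 2) ℂ

/-- The data in the computational basis state `x`, the ancillas freshly prepared. -/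
def Circuit.input {m : ℕ} (C : Circuit m) (x : Fin 7 → ZMod 2) : State m :=
  fun z => if (fun i => z (.data i)) = x then
    (∏ j, (C.prepAnc j).ket 0 (z (.anc j))) * C.prepFlag.ket 0 (z .flag) else 0

/-- The Kraus operator on the data qubits of the faulty circuit `C^F`, for the outcomes `b` of the
check ancillas and `f` of the flag. -/
def Circuit.kraus {m : ℕ} (C : Circuit m) (F : C.Fault) (b : Fin m → ZMod 2) (f : ZMod 2) :
    DataOp :=
  Matrix.of fun y x => ∑ a : Fin m → ZMod 2, ∑ g : ZMod 2,
    (∏ j, star ((C.measAnc j).ket (b j) (a j))) * star (C.measFlag.ket f g) *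
      C.run F (C.input x) (fun w => match w with
        | .data i => y i
        | .anc j => a j
        | .flag => g)

/-- The quantum instrument of `C^F` whose classical output is the flag outcome `f` and the decoded
syndrome `s = R b`: the (unnormalized) state of the data after these outcomes. -/
def Circuit.instrument {m : ℕ} (C : Circuit m) (R : Matrix (Fin 3) (Fin m) (ZMod 2))
    (F : C.Fault) (s : Fin 3 → ZMod 2) (f : ZMod 2) (ρ : DataOp) : DataOp :=
  ∑ b : Fin m → ZMod 2, if R *ᵥ b = s then C.kraus F b f * ρ * (C.kraus F b f)ᴴ else 0

/-! Fault-equivalence. -/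

/-- A fault is detectable if it makes the flag outcome `0` impossible. -/
def Circuit.Detectable {m : ℕ} (C : Circuit m) (F : C.Fault) : Prop :=
  ∀ b, C.kraus F b 0 = 0

/-- The faulty circuits `C₁^F₁` and `C₂^F₂` behave equally: for any outcomes that are decoded to
the same syndrome they act on the data by the same operator up to a nonzero scalar, and they have
the same statistics, that is, they define the same quantum instrument. -/
def SameBehaviour {m₁ m₂ : ℕ}
    (C₁ : Circuit m₁) (R₁ : Matrix (Fin 3) (Fin m₁) (ZMod 2)) (F₁ : C₁.Fault)
    (C₂ : Circuit m₂) (R₂ : Matrix (Fin 3) (Fin m₂) (ZMod 2)) (F₂ : C₂.Fault) : Prop :=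
  (∀ (b₁ : Fin m₁ → ZMod 2) (b₂ : Fin m₂ → ZMod 2) (f : ZMod 2), R₁ *ᵥ b₁ = R₂ *ᵥ b₂ →
    ∃ c : ℂ, c ≠ 0 ∧ C₁.kraus F₁ b₁ f = c • C₂.kraus F₂ b₂ f) ∧
  ∀ (s : Fin 3 → ZMod 2) (f : ZMod 2) (ρ : DataOp),
    C₁.instrument R₁ F₁ s f ρ = C₂.instrument R₂ F₂ s f ρ

/-- Every undetectable fault of `C₁` has the behaviour of a fault of `C₂` of at most its weight. -/
def FaultBounded {m₁ m₂ : ℕ}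
    (C₁ : Circuit m₁) (R₁ : Matrix (Fin 3) (Fin m₁) (ZMod 2))
    (C₂ : Circuit m₂) (R₂ : Matrix (Fin 3) (Fin m₂) (ZMod 2)) : Prop :=
  ∀ F₁ : C₁.Fault, C₁.Detectable F₁ ∨
    ∃ F₂ : C₂.Fault, C₂.weight F₂ ≤ C₁.weight F₁ ∧ SameBehaviour C₁ R₁ F₁ C₂ R₂ F₂

/-- Fault-equivalence (for faults of every weight) of circuits whose outcomes are decoded to
syndromes by `R₁` and `R₂`. -/
def FaultEquivalent {m₁ m₂ : ℕ}
    (C₁ : Circuit m₁) (R₁ : Matrix (Fin 3) (Fin m₁) (ZMod 2))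
    (C₂ : Circuit m₂) (R₂ : Matrix (Fin 3) (Fin m₂) (ZMod 2)) : Prop :=
  FaultBounded C₁ R₁ C₂ R₂ ∧ FaultBounded C₂ R₂ C₁ R₁

/-! The Steane code and its two syndrome extraction circuits. Qubits are numbered from `0`. -/

/-- The parity-check matrix `H_x = H_z` of the Steane code. -/
def parityCheck : Matrix (Fin 3) (Fin 7) (ZMod 2) :=
  !![1, 1, 1, 1, 0, 0, 0;
     0, 1, 1, 0, 1, 1, 0;
     0, 0, 1, 1, 0, 1, 1]

/-- The effective parity-check matrix `H'_x = H'_z`. -/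
def effectiveCheck : Matrix (Fin 3) (Fin 3) (ZMod 2) :=
  !![1, 1, 0;
     1, 1, 1;
     0, 1, 0]

/-- The `i`-th stabilizer generator of type `B`. -/
def stabilizer (B : Basis) (i : Fin 3) : DataOp :=
  pauliString fun q => if parityCheck i q = 1 then B.pauli else Pauli.I

/-- The projector onto the common eigenspace of the three generators of type `B` with eigenvalues
`(-1)^(s i)`. -/
def syndromeProj (B : Basis) (s : Fin 3 → ZMod 2) : DataOp :=
  ((List.finRange 3).map fun i =>
    (1 / 2 : ℂ) • (1 + (if s i = 0 then (1 : ℂ) else -1) • stabilizer B i)).prod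

/-- Without faults, the flag outcome is `0` and the circuit is a non-destructive measurement of the
type-`B` syndrome, whose outcome is `R b`. -/
def MeasuresSyndrome {m : ℕ} (B : Basis) (C : Circuit m)
    (R : Matrix (Fin 3) (Fin m) (ZMod 2)) : Prop :=
  (∀ b, C.kraus C.noFault b 1 = 0) ∧
  (∀ b, ∃ c : ℂ, c ≠ 0 ∧ C.kraus C.noFault b 0 = c • syndromeProj B (R *ᵥ b)) ∧
  ∀ (s : Fin 3 → ZMod 2) (ρ : DataOp),
    C.instrument R C.noFault s 0 ρ = syndromeProj B s * ρ * syndromeProj B s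

open Wire in
/-- Steane-style extraction of the `X` syndrome: Goto's preparation of the logical `|0⟩` on seven
ancillas (8 CNOTs) with its verification by the flag (3 CNOTs), a transversal CNOT from the
ancillas to the data, and `X` measurements of the ancillas. -/
def steaneStyleX : Circuit 7 where
  prepAnc := ![.X, .Z, .Z, .Z, .X, .Z, .X]
  prepFlag := .Z
  gates :=
    [(anc 4, anc 5), (anc 0, anc 1), (anc 6, anc 3), (anc 4, anc 2),
     (anc 6, anc 5), (anc 0, anc 3), (anc 4, anc 1), (anc 3, anc 2),
     (anc 5, flag), (anc 1, flag), (anc 3, flag),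
     (anc 0, data 0), (anc 1, data 1), (anc 2, data 2), (anc 3, data 3),
     (anc 4, data 4), (anc 5, data 5), (anc 6, data 6)]
  measAnc := fun _ => .X
  measFlag := .Z

open Wire in
/-- The optimized extraction of the `X` syndrome. The measurements of ancillas `0, 1, 2` are those
that remain of the measurements of ancillas `1, 2, 4` of the Steane-style circuit. -/
def optimizedX : Circuit 3 where
  prepAnc := fun _ => .X
  prepFlag := .Z
  gates :=
    [(anc 2, data 5), (anc 2, flag), (anc 1, anc 2), (anc 1, data 6),
     (anc 0, anc 1), (anc 0, data 0), (anc 1, data 3), (anc 1, flag),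
     (anc 2, anc 1), (anc 2, anc 0), (anc 2, data 4), (anc 0, flag),
     (anc 0, data 1), (anc 1, data 2)]
  measAnc := fun _ => .X
  measFlag := .Z

/-- The Steane-style circuit for the syndrome of type `B`. -/
def steaneStyle : Basis → Circuit 7
  | .X => steaneStyleX
  | .Z => steaneStyleX.dual

/-- The optimized circuit for the syndrome of type `B`. -/
def optimized : Basis → Circuit 3
  | .X => optimizedX
  | .Z => optimizedX.dual

/-- The number of ancillas (check ancillas and flag) of a circuit. -/
def Circuit.numAncillas {m : ℕ} (_ : Circuit m) : ℕ := m + 1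

end SteaneSE

end

namespace SteaneSE

/-! Signs and the symplectic representation of Pauli operators. -/

/-! A fault can be pushed to the end of the circuit: `X` spreads through a CNOT from control to
target, `Z` from target to control, and on the connecting edge the `X` part moves to the target, the
`Z` part to the control. Up to a phase, a faulty Kraus operator is thus a Pauli operator on the data
times a fault-free Kraus operator with flipped outcomes (`Circuit.run_phaseEq`, `Circuit.kraus_eq`).
The fault-free Kraus operators are multiples of syndrome projectors (`kraus_steaneStyleX` and its
three analogues), which absorb type-`B` stabilizers up to sign. So only 15 bits of a fault matter,
its `Effect`: the type-`B` data part modulo stabilizers, the other data part, the syndrome flip and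
the flag flip. Equal effects give equal behaviour (`sameBehaviour`).

The effect is additive in the fault, hence determined by faults on single edges. Evaluation shows
that the two circuits have the same unflagged single-edge effects, while each has two flagged ones
that the other lacks. A fault that flips the flag is detectable. Any other fault contains an even
number of flagged single-edge faults, which can be paired, and the sum of two flagged effects of one
circuit is always a sum of two single-edge effects of the other. Replacing unflagged faults one by
one and flagged ones in pairs never raises the weight (`exists_hammingNorm_le`, `exists_fault`). -/

lemma eq_zero_or_eq_one (a : ZMod 2) : a = 0 ∨ a = 1 := by
  revert a; decide

/-- The nontrivial additive character `a ↦ (-1)^a`. -/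
noncomputable def sgn (a : ZMod 2) : ℂ := if a = 0 then 1 else -1

@[simp] lemma sgn_zero : sgn 0 = 1 := by simp [sgn]

@[simp] lemma sgn_one : sgn 1 = -1 := by simp [sgn]

lemma sgn_add (a b : ZMod 2) : sgn (a + b) = sgn a * sgn b := by
  rcases eq_zero_or_eq_one a with rfl | rfl <;> rcases eq_zero_or_eq_one b with rfl | rfl <;>
    simp [CharTwo.add_self_eq_zero]

@[simp] lemma sgn_mul_self (a : ZMod 2) : sgn a * sgn a = 1 := by
  rcases eq_zero_or_eq_one a with rfl | rfl <;> simp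

@[simp] lemma norm_sgn (a : ZMod 2) : ‖sgn a‖ = 1 := by
  rcases eq_zero_or_eq_one a with rfl | rfl <;> simp

lemma sgn_sum {ι : Type*} (s : Finset ι) (f : ι → ZMod 2) :
    sgn (∑ i ∈ s, f i) = ∏ i ∈ s, sgn (f i) := by
  classical
  induction s using Finset.induction_on with
  | empty => simp
  | insert a s ha ih => rw [Finset.sum_insert ha, Finset.prod_insert ha, sgn_add, ih]

/-- The exponents of `X` and of `Z` in a Pauli operator. -/
def Pauli.bits : Pauli → ZMod 2 × ZMod 2
  | .I => (0, 0)
  | .X => (1, 0)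
  | .Y => (1, 1)
  | .Z => (0, 1)

/-- The Pauli operator with given exponents of `X` and `Z`. -/
def Pauli.ofBits (a : ZMod 2 × ZMod 2) : Pauli :=
  if a.1 = 0 then (if a.2 = 0 then .I else .Z) else (if a.2 = 0 then .X else .Y)

lemma Pauli.bits_ofBits (a : ZMod 2 × ZMod 2) : (Pauli.ofBits a).bits = a := by
  revert a; decide

lemma Pauli.bits_eq_zero {P : Pauli} : P.bits = 0 ↔ P = .I := by
  cases P <;> simp [Pauli.bits]

/-- The scalar by which a Pauli operator differs from `Z^b X^a`. -/
noncomputable def Pauli.phase : Pauli → ℂ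
  | .Y => -Complex.I
  | _ => 1

lemma Pauli.norm_phase (P : Pauli) : ‖P.phase‖ = 1 := by
  cases P <;> simp [Pauli.phase]

lemma Pauli.mat_eq (P : Pauli) (a b : ZMod 2) :
    P.mat a b = P.phase * (sgn (P.bits.2 * a) * if b = a + P.bits.1 then 1 else 0) := by
  rcases eq_zero_or_eq_one a with rfl | rfl <;> rcases eq_zero_or_eq_one b with rfl | rfl <;>
    cases P <;> simp [Pauli.mat, Pauli.phase, Pauli.bits, CharTwo.add_self_eq_zero]

/-! Pauli operators on all wires. -/

/-- The `X` part and the `Z` part of a Pauli operator on all wires. -/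
abbrev Frame (m : ℕ) : Type := (Wire m → ZMod 2) × (Wire m → ZMod 2)

/-- The operator `Z^z X^x` for the frame `(x, z)`. -/
noncomputable def weyl {m : ℕ} (p : Frame m) (ψ : State m) : State m :=
  fun y => sgn (p.2 ⬝ᵥ y) * ψ (y + p.1)

/-- Equality of operators up to a global phase. -/
def PhaseEq {m : ℕ} (A B : State m → State m) : Prop :=
  ∃ c : ℂ, ‖c‖ = 1 ∧ ∀ ψ, A ψ = c • B ψ

lemma weyl_smul {m : ℕ} (p : Frame m) (c : ℂ) (ψ : State m) :
    weyl p (c • ψ) = c • weyl p ψ := by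
  ext y; simp only [weyl, Pi.smul_apply, smul_eq_mul]; ring

lemma weyl_weyl {m : ℕ} (p q : Frame m) (ψ : State m) :
    weyl p (weyl q ψ) = sgn (q.2 ⬝ᵥ p.1) • weyl (p + q) ψ := by
  ext y
  simp only [weyl, Pi.smul_apply, smul_eq_mul, Prod.fst_add, Prod.snd_add, dotProduct_add,
    add_dotProduct, sgn_add, add_assoc]
  ring

lemma weyl_zero {m : ℕ} (ψ : State m) : weyl 0 ψ = ψ := by
  ext y; simp [weyl]

/-- The action of a CNOT on computational basis states. -/
def cnotBits {m : ℕ} (g : Wire m × Wire m) (v : Wire m → ZMod 2) : Wire m → ZMod 2 :=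
  Function.update v g.2 (v g.2 + v g.1)

lemma cnotBits_add {m : ℕ} (g : Wire m × Wire m) (v w : Wire m → ZMod 2) :
    cnotBits g (v + w) = cnotBits g v + cnotBits g w := by
  ext q
  by_cases h : q = g.2
  · subst h; simp only [cnotBits, Function.update_self, Pi.add_apply]; ring
  · simp [cnotBits, h]

lemma cnotBits_eq {m : ℕ} (g : Wire m × Wire m) (v : Wire m → ZMod 2) :
    cnotBits g v = v + Pi.single g.2 (v g.1) := by
  ext q
  by_cases h : q = g.2
  · subst h; simp [cnotBits]
  · simp [cnotBits, h]

lemma cnotBits_cnotBits {m : ℕ} {g : Wire m × Wire m} (hg : g.1 ≠ g.2) (v : Wire m → ZMod 2) :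
    cnotBits g (cnotBits g v) = v := by
  ext q
  by_cases h : q = g.2
  · subst h
    simp only [cnotBits, Function.update_self, Function.update_of_ne hg]
    rw [add_assoc, CharTwo.add_self_eq_zero, add_zero]
  · simp [cnotBits, h]

/-- A CNOT without faults. -/
def cnot {m : ℕ} (g : Wire m × Wire m) (ψ : State m) : State m := fun y => ψ (cnotBits g y)

/-- Conjugation of a Pauli operator by a CNOT. -/
def cnotFrame {m : ℕ} (g : Wire m × Wire m) (p : Frame m) : Frame m :=
  (cnotBits g p.1, cnotBits g.swap p.2)

/-- The transpose of a CNOT, as a linear map over `ZMod 2`, is the CNOT with control and target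
exchanged. This is why `Z` parts propagate backwards in `cnotFrame`. -/
lemma cnotBits_swap_dotProduct {m : ℕ} (g : Wire m × Wire m) (z y : Wire m → ZMod 2) :
    cnotBits g.swap z ⬝ᵥ y = z ⬝ᵥ cnotBits g y := by
  rw [cnotBits_eq, cnotBits_eq, add_dotProduct, dotProduct_add]
  simp [single_dotProduct, dotProduct_single]

lemma cnot_weyl {m : ℕ} {g : Wire m × Wire m} (hg : g.1 ≠ g.2) (p : Frame m) (ψ : State m) :
    cnot g (weyl p ψ) = weyl (cnotFrame g p) (cnot g ψ) := by
  ext y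
  simp only [cnot, weyl, cnotFrame, cnotBits_swap_dotProduct, cnotBits_add, cnotBits_cnotBits hg]

/-! Propagation of faults to the end of a circuit. -/

lemma applyPauli_eq {m : ℕ} (q : Wire m) (P : Pauli) (ψ : State m) :
    applyPauli q P ψ = P.phase • weyl (Pi.single q P.bits.1, Pi.single q P.bits.2) ψ := by
  ext y
  have h : ∀ b, Function.update y q (y q + b) = y + Pi.single q b := by
    intro b; ext w
    by_cases hw : w = q
    · subst hw; simp
    · simp [hw]
  simp only [applyPauli, Pauli.mat_eq, weyl, Pi.smul_apply, smul_eq_mul, single_dotProduct]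
  rw [Finset.sum_eq_single (y q + P.bits.1)]
  · simp [h, mul_assoc]
  · intro b _ hb; simp [hb]
  · simp

/-- The link ends in a `Z`-spider on the control and an `X`-spider on the target. An `X` on it
passes through the latter onto the target, a `Z` through the former onto the control. -/
lemma applyCNOT_eq {m : ℕ} {g : Wire m × Wire m} (hg : g.1 ≠ g.2) (P : Pauli) (ψ : State m) :
    applyCNOT g.1 g.2 P ψ = (P.phase * sgn (P.bits.2 * P.bits.1)) •
      weyl (Pi.single g.2 P.bits.1, Pi.single g.1 P.bits.2) (cnot g ψ) := by
  ext y
  have h : cnotBits g (y + Pi.single g.2 P.bits.1) =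
      Function.update y g.2 (y g.2 + (y g.1 + P.bits.1)) := by
    ext w
    by_cases hw : w = g.2
    · subst hw; simp [cnotBits, hg]; ring
    · simp [cnotBits, hw]
  have h' : ∀ b, y g.1 = b + P.bits.1 ↔ b = y g.1 + P.bits.1 := by
    intro b; constructor
    · intro e; rw [e, add_assoc, CharTwo.add_self_eq_zero, add_zero]
    · intro e; rw [e, add_assoc, CharTwo.add_self_eq_zero, add_zero]
  simp only [applyCNOT, Pauli.mat_eq, weyl, cnot, Pi.smul_apply, smul_eq_mul, single_dotProduct,
    h, h']
  rw [Finset.sum_eq_single (y g.1 + P.bits.1)]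
  · simp only [if_true, mul_add, sgn_add]; ring
  · intro b _ hb; simp [hb]
  · simp

lemma pauliString_mulVec {m : ℕ} (P : Wire m → Pauli) (ψ : State m) :
    pauliString P *ᵥ ψ =
      (∏ q, (P q).phase) • weyl (fun q => (P q).bits.1, fun q => (P q).bits.2) ψ := by
  ext y
  simp only [Matrix.mulVec, dotProduct, pauliString, Matrix.of_apply, Pauli.mat_eq,
    Finset.prod_mul_distrib, weyl, Pi.smul_apply, smul_eq_mul, sgn_sum]
  rw [Finset.sum_eq_single (y + fun q => (P q).bits.1)]
  · simp [mul_assoc]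
  · intro b _ hb
    obtain ⟨q, hq⟩ := Function.ne_iff.1 hb
    have h0 : ∏ q, (if b q = y q + (P q).bits.1 then (1 : ℂ) else 0) = 0 :=
      Finset.prod_eq_zero (Finset.mem_univ q) (if_neg hq)
    rw [h0]; simp
  · simp

/-- The Pauli operator that the faults at a gate insert after it; the arguments are the bits of
the faults on the link, the control and the target. -/
def gateError {m : ℕ} (g : Wire m × Wire m) (l c t : ZMod 2 × ZMod 2) : Frame m :=
  (Pi.single g.2 (l.1 + t.1) + Pi.single g.1 c.1, Pi.single g.1 (l.2 + c.2) + Pi.single g.2 t.2)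

lemma gateError_add {m : ℕ} (g : Wire m × Wire m) (l c t l' c' t' : ZMod 2 × ZMod 2) :
    gateError g (l + l') (c + c') (t + t') = gateError g l c t + gateError g l' c' t' := by
  simp only [gateError, Prod.fst_add, Prod.snd_add, Pi.single_add, Prod.mk_add_mk]
  ext1 <;> simp only <;> abel

/-- The bits of a fault. -/
def Circuit.bits {m : ℕ} {C : Circuit m} (F : C.Fault) : C.Edge → ZMod 2 × ZMod 2 :=
  fun e => (F e).bits

/-- The effect of the `i`-th gate and its faults on a Pauli frame. -/
def Circuit.stepFrame {m : ℕ} (C : Circuit m) (ξ : C.Edge → ZMod 2 × ZMod 2) (p : Frame m)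
    (i : Fin C.gates.length) : Frame m :=
  gateError (C.gates.get i) (ξ (.inr (i, .link))) (ξ (.inr (i, .control))) (ξ (.inr (i, .target))) +
    cnotFrame (C.gates.get i) p

/-- The Pauli operator at the end of the circuit that is equivalent to a fault. -/
def Circuit.frame {m : ℕ} (C : Circuit m) (ξ : C.Edge → ZMod 2 × ZMod 2) : Frame m :=
  (List.finRange C.gates.length).foldl (C.stepFrame ξ)
    (fun q => (ξ (.inl q)).1, fun q => (ξ (.inl q)).2)

lemma Circuit.stepFrame_add {m : ℕ} (C : Circuit m) (ξ η : C.Edge → ZMod 2 × ZMod 2)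
    (p q : Frame m) (i : Fin C.gates.length) :
    C.stepFrame (ξ + η) (p + q) i = C.stepFrame ξ p i + C.stepFrame η q i := by
  have h : cnotFrame (C.gates.get i) (p + q) =
      cnotFrame (C.gates.get i) p + cnotFrame (C.gates.get i) q := by
    simp only [cnotFrame, Prod.fst_add, Prod.snd_add, cnotBits_add, Prod.mk_add_mk]
  simp only [stepFrame, Pi.add_apply, gateError_add, h]
  abel

/-- Additivity is what reduces arbitrary faults to faults on single edges. -/
lemma Circuit.frame_add {m : ℕ} (C : Circuit m) (ξ η : C.Edge → ZMod 2 × ZMod 2) :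
    C.frame (ξ + η) = C.frame ξ + C.frame η := by
  have h : ∀ (l : List (Fin C.gates.length)) (p q : Frame m),
      l.foldl (C.stepFrame (ξ + η)) (p + q) =
        l.foldl (C.stepFrame ξ) p + l.foldl (C.stepFrame η) q := by
    intro l
    induction l with
    | nil => intro p q; rfl
    | cons i l ih => intro p q; simp only [List.foldl_cons, stepFrame_add, ih]
  rw [frame, frame, frame, ← h]
  rfl

/-- All gates without faults. -/
def Circuit.runIdeal {m : ℕ} (C : Circuit m) (ψ : State m) : State m :=
  (List.finRange C.gates.length).foldl (fun ψ i => cnot (C.gates.get i) ψ) ψ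

lemma PhaseEq.applyPauli {m : ℕ} {A B : State m → State m} {p : Frame m}
    (h : PhaseEq A fun ψ => weyl p (B ψ)) (q : Wire m) (P : Pauli) :
    PhaseEq (fun ψ => applyPauli q P (A ψ))
      fun ψ => weyl ((Pi.single q P.bits.1, Pi.single q P.bits.2) + p) (B ψ) := by
  obtain ⟨c, hc, h⟩ := h
  refine ⟨P.phase * (c * sgn (p.2 ⬝ᵥ Pi.single q P.bits.1)), by simp [hc, P.norm_phase], ?_⟩
  intro ψ
  simp only [h, applyPauli_eq, weyl_smul, weyl_weyl, smul_smul]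

lemma PhaseEq.applyCNOT {m : ℕ} {A B : State m → State m} {p : Frame m}
    (h : PhaseEq A fun ψ => weyl p (B ψ)) {g : Wire m × Wire m} (hg : g.1 ≠ g.2) (P : Pauli) :
    PhaseEq (fun ψ => applyCNOT g.1 g.2 P (A ψ))
      fun ψ => weyl ((Pi.single g.2 P.bits.1, Pi.single g.1 P.bits.2) + cnotFrame g p)
        (cnot g (B ψ)) := by
  obtain ⟨c, hc, h⟩ := h
  refine ⟨P.phase * sgn (P.bits.2 * P.bits.1) *
    (c * sgn ((cnotFrame g p).2 ⬝ᵥ Pi.single g.2 P.bits.1)), by simp [hc, P.norm_phase], ?_⟩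
  intro ψ
  have e : ∀ φ : State m, cnot g (c • φ) = c • cnot g φ := fun _ => rfl
  simp only [h, applyCNOT_eq hg, e, cnot_weyl hg, weyl_smul, weyl_weyl, smul_smul]

lemma PhaseEq.step {m : ℕ} {C : Circuit m} {A B : State m → State m} {p : Frame m}
    (h : PhaseEq A fun ψ => weyl p (B ψ)) (F : C.Fault) (i : Fin C.gates.length)
    (hg : (C.gates.get i).1 ≠ (C.gates.get i).2) :
    PhaseEq (fun ψ => C.step F (A ψ) i)
      fun ψ => weyl (C.stepFrame (Circuit.bits F) p i) (cnot (C.gates.get i) (B ψ)) := by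
  have e := ((h.applyCNOT hg (F (.inr (i, .link)))).applyPauli (C.gates.get i).1
    (F (.inr (i, .control)))).applyPauli (C.gates.get i).2 (F (.inr (i, .target)))
  have e' : C.stepFrame (Circuit.bits F) p i =
      (Pi.single (C.gates.get i).2 (F (.inr (i, .target))).bits.1,
        Pi.single (C.gates.get i).2 (F (.inr (i, .target))).bits.2) +
      ((Pi.single (C.gates.get i).1 (F (.inr (i, .control))).bits.1,
        Pi.single (C.gates.get i).1 (F (.inr (i, .control))).bits.2) +
       ((Pi.single (C.gates.get i).2 (F (.inr (i, .link))).bits.1,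
        Pi.single (C.gates.get i).1 (F (.inr (i, .link))).bits.2) +
          cnotFrame (C.gates.get i) p)) := by
    simp only [Circuit.stepFrame, gateError, Circuit.bits, Pi.single_add]
    ext1 <;> simp only [Prod.fst_add, Prod.snd_add] <;> abel
  rw [e']
  exact e

lemma Circuit.run_phaseEq {m : ℕ} (C : Circuit m) (hC : ∀ g ∈ C.gates, g.1 ≠ g.2) (F : C.Fault) :
    PhaseEq (C.run F) fun ψ => weyl (C.frame (bits F)) (C.runIdeal ψ) := by
  -- Invariant of the fold: the faulty evolution so far is, up to a phase, the ideal evolution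
  -- followed by the tracked frame.
  have h : ∀ (l : List (Fin C.gates.length)) (A B : State m → State m) (p : Frame m),
      PhaseEq A (fun ψ => weyl p (B ψ)) →
      PhaseEq (fun ψ => l.foldl (C.step F) (A ψ)) fun ψ =>
        weyl (l.foldl (C.stepFrame (bits F)) p)
          (l.foldl (fun ψ i => cnot (C.gates.get i) ψ) (B ψ)) := by
    intro l
    induction l with
    | nil => intro A B p h; exact h
    | cons i l ih =>
      intro A B p h
      simp only [List.foldl_cons]
      exact ih _ _ _ (h.step F i (hC _ (List.get_mem _ _)))
  refine h _ _ id _ ⟨∏ q, (F (.inl q)).phase, by simp [Pauli.norm_phase], fun ψ => ?_⟩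
  exact pauliString_mulVec _ _

/-- `Circuit.run_phaseEq` leaves a phase undetermined; here all phases are trivial, so fault-free
Kraus operators can be computed exactly. -/
lemma Circuit.run_noFault {m : ℕ} (C : Circuit m) (hC : ∀ g ∈ C.gates, g.1 ≠ g.2) (ψ : State m) :
    C.run C.noFault ψ = C.runIdeal ψ := by
  have h0 : ∀ (q : Wire m) (φ : State m), SteaneSE.applyPauli q .I φ = φ := by
    intro q φ
    rw [applyPauli_eq]
    simp only [Pauli.phase, Pauli.bits, Pi.single_zero, one_smul]
    exact weyl_zero φ
  have h1 : ∀ (φ : State m) (i : Fin C.gates.length),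
      C.step C.noFault φ i = cnot (C.gates.get i) φ := by
    intro φ i
    simp only [step, noFault, h0]
    rw [applyCNOT_eq (hC _ (List.get_mem _ _))]
    simp only [Pauli.phase, Pauli.bits, Pi.single_zero, mul_zero, sgn_zero, one_mul, one_smul]
    exact weyl_zero _
  have h2 : (pauliString fun q : Wire m => C.noFault (.inl q)) *ᵥ ψ = ψ := by
    rw [pauliString_mulVec]
    simp only [noFault, Pauli.phase, Pauli.bits, Finset.prod_const_one, one_smul]
    exact weyl_zero ψ
  have h3 : C.step C.noFault = fun φ i => cnot (C.gates.get i) φ := by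
    ext1 φ; ext1 i; exact h1 φ i
  rw [run, runIdeal, h2, h3]

/-! Kraus operators of faulty circuits. -/

/-- The assignment of bits to all wires with given restrictions to data, check ancillas and flag. -/
def join {m : ℕ} (y : Fin 7 → ZMod 2) (a : Fin m → ZMod 2) (g : ZMod 2) : Wire m → ZMod 2
  | .data i => y i
  | .anc j => a j
  | .flag => g

/-- The wires as a sum type. -/
def wireEquiv (m : ℕ) : Wire m ≃ (Fin 7 ⊕ Fin m) ⊕ Unit where
  toFun
    | .data i => .inl (.inl i)
    | .anc j => .inl (.inr j)
    | .flag => .inr ()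
  invFun
    | .inl (.inl i) => .data i
    | .inl (.inr j) => .anc j
    | .inr () => .flag
  left_inv w := by cases w <;> rfl
  right_inv w := by rcases w with (i | j) | u <;> rfl

lemma sum_wire {m : ℕ} {M : Type*} [AddCommMonoid M] (h : Wire m → M) :
    ∑ w, h w = ∑ i, h (.data i) + ∑ j, h (.anc j) + h .flag := by
  rw [← (wireEquiv m).symm.sum_comp h, Fintype.sum_sum_type, Fintype.sum_sum_type]
  simp [wireEquiv]

lemma join_add {m : ℕ} (y y' : Fin 7 → ZMod 2) (a a' : Fin m → ZMod 2) (g g' : ZMod 2) :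
    join (y + y') (a + a') (g + g') = join y a g + join y' a' g' := by
  ext w; cases w <;> rfl

lemma join_self {m : ℕ} (v : Wire m → ZMod 2) :
    join (fun i => v (.data i)) (fun j => v (.anc j)) (v .flag) = v := by
  ext w; cases w <;> rfl

/-- The part of a Pauli operator that anticommutes with a measurement basis. -/
def Basis.flip (B : Basis) {m : ℕ} (p : Frame m) : Wire m → ZMod 2 :=
  match B with
  | .Z => p.1
  | .X => p.2

lemma Basis.flip_add (B : Basis) {m : ℕ} (p q : Frame m) :
    B.flip (p + q) = B.flip p + B.flip q := by
  cases B <;> rfl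

/-- The sign relating a measurement outcome after a Pauli operator to a flipped outcome. -/
noncomputable def Basis.flipSign (B : Basis) (b x z : ZMod 2) : ℂ :=
  match B with
  | .Z => sgn (z * b)
  | .X => sgn ((b + z) * x)

lemma Basis.norm_flipSign (B : Basis) (b x z : ZMod 2) : ‖B.flipSign b x z‖ = 1 := by
  cases B <;> simp [Basis.flipSign]

lemma Basis.ket_X (b a : ZMod 2) : Basis.X.ket b a = sgn (b * a) / (Real.sqrt 2 : ℂ) := by
  rcases eq_zero_or_eq_one a with rfl | rfl <;> rcases eq_zero_or_eq_one b with rfl | rfl <;>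
    simp [Basis.ket]

lemma star_sgn (a : ZMod 2) : star (sgn a) = sgn a := by
  rcases eq_zero_or_eq_one a with rfl | rfl <;> simp

lemma Basis.star_ket (B : Basis) (b a : ZMod 2) : star (B.ket b a) = B.ket b a := by
  cases B
  · simp only [Basis.ket]; split_ifs <;> simp
  · rw [Basis.ket_X, star_div₀, star_sgn]; simp

/-- A Pauli operator just before a measurement is absorbed by the measured state: the part
anticommuting with the basis flips the outcome, the rest costs only a sign. -/
lemma Basis.ket_mul_sgn (B : Basis) (b a : ZMod 2) {m : ℕ} (p : Frame m) (w : Wire m) :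
    B.ket b a * sgn (p.2 w * a) =
      B.flipSign b (p.1 w) (p.2 w) * B.ket (b + B.flip p w) (a + p.1 w) := by
  cases B
  · simp only [Basis.ket, Basis.flipSign, Basis.flip, add_left_inj]
    split_ifs with h
    · rw [h]; ring
    · simp
  · simp only [Basis.ket_X, Basis.flipSign, Basis.flip]
    have : sgn ((b + p.2 w) * (a + p.1 w)) =
        sgn ((b + p.2 w) * p.1 w) * (sgn (b * a) * sgn (p.2 w * a)) := by
      rw [← sgn_add, ← sgn_add]; congr 1; ring
    rw [this, ← mul_div_assoc, ← mul_assoc, sgn_mul_self, one_mul, div_mul_eq_mul_div]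

lemma Circuit.kraus_noFault {m : ℕ} (C : Circuit m) (hC : ∀ g ∈ C.gates, g.1 ≠ g.2)
    (b : Fin m → ZMod 2) (f : ZMod 2) (y x : Fin 7 → ZMod 2) :
    C.kraus C.noFault b f y x = ∑ a : Fin m → ZMod 2, ∑ g : ZMod 2,
      (∏ j, (C.measAnc j).ket (b j) (a j)) * C.measFlag.ket f g *
        C.runIdeal (C.input x) (join y a g) := by
  simp only [kraus, Matrix.of_apply, Basis.star_ket, run_noFault C hC]
  rfl

/-- A fault acts on each Kraus operator as a Pauli operator on the data together with flips of the
outcomes. -/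
lemma Circuit.kraus_eq {m : ℕ} (C : Circuit m) (hC : ∀ g ∈ C.gates, g.1 ≠ g.2) (F : C.Fault)
    (b : Fin m → ZMod 2) (f : ZMod 2) :
    ∃ c : ℂ, ‖c‖ = 1 ∧ ∀ y x, C.kraus F b f y x =
      c * (sgn ((fun i => (C.frame (bits F)).2 (.data i)) ⬝ᵥ y) *
        C.kraus C.noFault (b + fun j => (C.measAnc j).flip (C.frame (bits F)) (.anc j))
          (f + C.measFlag.flip (C.frame (bits F)) .flag)
          (y + fun i => (C.frame (bits F)).1 (.data i)) x) := by
  obtain ⟨c, hc, h⟩ := C.run_phaseEq hC F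
  set p := C.frame (bits F)
  refine ⟨c * ((∏ j, (C.measAnc j).flipSign (b j) (p.1 (.anc j)) (p.2 (.anc j))) *
    C.measFlag.flipSign f (p.1 .flag) (p.2 .flag)), ?_, fun y x => ?_⟩
  · simp [hc, Basis.norm_flipSign]
  have e : C.kraus F b f y x = ∑ a : Fin m → ZMod 2, ∑ g : ZMod 2,
      (∏ j, (C.measAnc j).ket (b j) (a j)) * C.measFlag.ket f g *
        (c * (sgn (p.2 ⬝ᵥ join y a g) * C.runIdeal (C.input x) (join y a g + p.1))) := by
    simp only [kraus, Matrix.of_apply, Basis.star_ket, h]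
    rfl
  rw [e, kraus_noFault C hC, Finset.mul_sum, Finset.mul_sum]
  -- The `X` part of the frame on the ancillas translates the summation variables.
  refine Fintype.sum_equiv (Equiv.addRight fun j => p.1 (Wire.anc j)) _ _ fun a => ?_
  rw [Finset.mul_sum, Finset.mul_sum]
  refine Fintype.sum_equiv (Equiv.addRight (p.1 Wire.flag)) _ _ fun g => ?_
  have e1 : sgn (p.2 ⬝ᵥ join y a g) = sgn ((fun i => p.2 (.data i)) ⬝ᵥ y) *
      (∏ j, sgn (p.2 (.anc j) * a j)) * sgn (p.2 .flag * g) := by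
    rw [← sgn_sum, ← sgn_add, ← sgn_add, dotProduct, sum_wire]
    rfl
  have e2 : (∏ j, (C.measAnc j).ket (b j) (a j)) * ∏ j, sgn (p.2 (.anc j) * a j) =
      (∏ j, (C.measAnc j).flipSign (b j) (p.1 (.anc j)) (p.2 (.anc j))) *
        ∏ j, (C.measAnc j).ket (b j + (C.measAnc j).flip p (.anc j)) (a j + p.1 (.anc j)) := by
    rw [← Finset.prod_mul_distrib, ← Finset.prod_mul_distrib]
    exact Finset.prod_congr rfl fun j _ => Basis.ket_mul_sgn _ _ _ _ _
  have e3 := Basis.ket_mul_sgn C.measFlag f g p .flag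
  have e4 : join (y + fun i => p.1 (.data i)) (a + fun j => p.1 (.anc j)) (g + p.1 .flag) =
      join y a g + p.1 := by
    rw [join_add, join_self]
  simp only [Equiv.coe_addRight, e4, e1, Pi.add_apply]
  linear_combination c * sgn ((fun i => p.2 (.data i)) ⬝ᵥ y) *
    C.runIdeal (C.input x) (join y a g + p.1) * (C.measFlag.ket f g * sgn (p.2 .flag * g)) * e2 +
    c * sgn ((fun i => p.2 (.data i)) ⬝ᵥ y) *
    C.runIdeal (C.input x) (join y a g + p.1) *
    ((∏ j, (C.measAnc j).flipSign (b j) (p.1 (.anc j)) (p.2 (.anc j))) *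
      ∏ j, (C.measAnc j).ket (b j + (C.measAnc j).flip p (.anc j)) (a j + p.1 (.anc j))) * e3

/-! ### Weight-preserving transfer between additive error models. -/

/-- If each single error of the first model, and each pair of flagged single errors, is reproduced
in the second model without an increase of weight, then so is each unflagged error. -/
lemma exists_hammingNorm_le {E₁ E₂ A V : Type*} [Fintype E₁] [Fintype E₂] [DecidableEq E₁]
    [AddCommGroup A] [DecidableEq A] [AddCommGroup V]
    (T₁ : (E₁ → A) →+ V) (T₂ : (E₂ → A) →+ V) (flag : V →+ ZMod 2)
    (hV : ∀ v : V, v + v = 0)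
    (h₁ : ∀ e a, flag (T₁ (Pi.single e a)) = 0 →
      ∃ η, hammingNorm η ≤ 1 ∧ T₂ η = T₁ (Pi.single e a))
    (h₂ : ∀ e a e' a', flag (T₁ (Pi.single e a)) = 1 → flag (T₁ (Pi.single e' a')) = 1 →
      ∃ η, hammingNorm η ≤ 2 ∧ T₂ η = T₁ (Pi.single e a) + T₁ (Pi.single e' a'))
    (ξ : E₁ → A) (hξ : flag (T₁ ξ) = 0) :
    ∃ η, hammingNorm η ≤ hammingNorm ξ ∧ T₂ η = T₁ ξ := by
  have norm_add : ∀ η η' : E₂ → A, hammingNorm (η + η') ≤ hammingNorm η + hammingNorm η' := by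
    intro η η'
    classical
    refine (Finset.card_le_card fun e he => ?_).trans (Finset.card_union_le _ _)
    simp only [Finset.mem_filter, Finset.mem_univ, true_and, Finset.mem_union] at he ⊢
    by_contra! h
    exact he (by rw [Pi.add_apply, h.1, h.2, add_zero])
  have reach_add : ∀ {n n' : ℕ} {v v' : V}, (∃ η, hammingNorm η ≤ n ∧ T₂ η = v) →
      (∃ η, hammingNorm η ≤ n' ∧ T₂ η = v') → ∃ η, hammingNorm η ≤ n + n' ∧ T₂ η = v + v' := by
    rintro n n' v v' ⟨η, hn, rfl⟩ ⟨η', hn', rfl⟩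
    exact ⟨η + η', (norm_add _ _).trans (add_le_add hn hn'), map_add _ _ _⟩
  -- In the flagged case one flagged single error is held in reserve: the rest of the partial sum is
  -- reproduced with weight one less than `S.card`, until a second flagged error arrives to form a
  -- pair.
  have key : ∀ S : Finset E₁,
      (flag (∑ e ∈ S, T₁ (Pi.single e (ξ e))) = 0 →
        ∃ η, hammingNorm η ≤ S.card ∧ T₂ η = ∑ e ∈ S, T₁ (Pi.single e (ξ e))) ∧
      (flag (∑ e ∈ S, T₁ (Pi.single e (ξ e))) = 1 →
        ∃ e a, flag (T₁ (Pi.single e a)) = 1 ∧ ∃ η, hammingNorm η + 1 ≤ S.card ∧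
          T₂ η = ∑ e ∈ S, T₁ (Pi.single e (ξ e)) + T₁ (Pi.single e a)) := by
    intro S
    induction S using Finset.induction_on with
    | empty => exact ⟨fun _ => ⟨0, by simp, by simp⟩, fun h => by simp at h⟩
    | insert i S hi ih =>
      rw [Finset.sum_insert hi, Finset.card_insert_of_notMem hi, map_add]
      set v := T₁ (Pi.single i (ξ i)) with hv
      set w := ∑ e ∈ S, T₁ (Pi.single e (ξ e))
      rcases eq_zero_or_eq_one (flag v) with h0 | h0 <;>
        rcases eq_zero_or_eq_one (flag w) with h1 | h1 <;> rw [h0, h1]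
      · refine ⟨fun _ => ?_, fun h => by simp at h⟩
        rw [add_comm v]
        exact reach_add (ih.1 h1) (h₁ _ _ h0)
      · refine ⟨fun h => by simp at h, fun _ => ?_⟩
        obtain ⟨e, a, ha, η, hn, hη⟩ := ih.2 h1
        obtain ⟨η', hn', hη'⟩ := h₁ _ _ h0
        exact ⟨e, a, ha, η + η', by have := norm_add η η'; omega, by
          rw [map_add, hη, hη']; abel⟩
      · refine ⟨fun h => by simp at h, fun _ => ?_⟩
        obtain ⟨η, hn, hη⟩ := ih.1 h1
        -- The new flagged error becomes the reserve; adding it twice cancels by `hV`.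
        exact ⟨i, ξ i, h0, η, by omega, by rw [hη, add_right_comm, hV, zero_add]⟩
      · refine ⟨fun _ => ?_, fun h => absurd h (by decide)⟩
        obtain ⟨e, a, ha, η, hn, hη⟩ := ih.2 h1
        -- The new flagged error is paired with the reserve. The pair costs two: one saved earlier,
        -- one for `i`.
        obtain ⟨η', hn', hη'⟩ := h₂ _ _ _ _ h0 ha
        refine ⟨η + η', by have := norm_add η η'; omega, ?_⟩
        rw [map_add, hη, hη', add_add_add_comm, ← hv, hV, add_zero, add_comm]
  have hsum : ∀ S : Finset E₁, (∀ e ∉ S, ξ e = 0) → T₁ ξ = ∑ e ∈ S, T₁ (Pi.single e (ξ e)) := by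
    intro S hS
    conv_lhs => rw [← Finset.univ_sum_single ξ]
    rw [map_sum]
    refine (Finset.sum_subset (Finset.subset_univ S) fun e _ he => ?_).symm
    rw [hS e he, Pi.single_zero, map_zero]
  have h := hsum {e | ξ e ≠ 0} (by simp)
  rw [h] at hξ ⊢
  exact (key _).1 hξ

/-! Propagation of the faults on a single edge. -/

/-- Conjugation of a Pauli operator by a list of CNOTs. -/
def propagate {m : ℕ} (l : List (Wire m × Wire m)) (p : Frame m) : Frame m :=
  l.foldl (fun p g => cnotFrame g p) p

/-- The Pauli operator that a fault on an edge of a CNOT inserts after it. -/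
def legFrame {m : ℕ} (g : Wire m × Wire m) (a : ZMod 2 × ZMod 2) : Leg → Frame m
  | .link => (Pi.single g.2 a.1, Pi.single g.1 a.2)
  | .control => (Pi.single g.1 a.1, Pi.single g.1 a.2)
  | .target => (Pi.single g.2 a.1, Pi.single g.2 a.2)

lemma cnotFrame_zero {m : ℕ} (g : Wire m × Wire m) : cnotFrame g 0 = 0 := by
  simp [cnotFrame, cnotBits]

lemma gateError_zero {m : ℕ} (g : Wire m × Wire m) : gateError g 0 0 0 = 0 := by
  simp [gateError]

lemma Circuit.foldl_stepFrame {m : ℕ} (C : Circuit m) (ξ : C.Edge → ZMod 2 × ZMod 2)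
    (l : List (Fin C.gates.length)) (hl : ∀ i ∈ l, ∀ s, ξ (.inr (i, s)) = 0) (p : Frame m) :
    l.foldl (C.stepFrame ξ) p = propagate (l.map C.gates.get) p := by
  induction l generalizing p with
  | nil => rfl
  | cons i l ih =>
    have h := hl i (by simp)
    rw [List.foldl_cons, ih (fun j hj => hl j (by simp [hj])), stepFrame, h, h, h, gateError_zero,
      zero_add]
    rfl

lemma propagate_zero {m : ℕ} (l : List (Wire m × Wire m)) : propagate l 0 = 0 := by
  induction l with
  | nil => rfl
  | cons g l ih => rw [propagate, List.foldl_cons, cnotFrame_zero]; exact ih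

lemma Circuit.frame_single_inl {m : ℕ} (C : Circuit m) (w : Wire m) (a : ZMod 2 × ZMod 2) :
    C.frame (Pi.single (.inl w) a) = propagate C.gates (Pi.single w a.1, Pi.single w a.2) := by
  have h : (fun q => (Pi.single (M := fun _ => ZMod 2 × ZMod 2) (.inl w : C.Edge) a (.inl q)).1,
      fun q => (Pi.single (M := fun _ => ZMod 2 × ZMod 2) (.inl w : C.Edge) a (.inl q)).2) =
      ((Pi.single w a.1, Pi.single w a.2) : Frame m) := by
    ext q <;> by_cases hq : q = w <;> simp [hq]
  rw [frame, foldl_stepFrame _ _ _ (by simp), h]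
  simp

/-- The frame stays zero up to the faulty gate, which inserts `legFrame`; the later gates only
conjugate it. -/
lemma Circuit.frame_single_inr {m : ℕ} (C : Circuit m) (i : Fin C.gates.length) (s : Leg)
    (a : ZMod 2 × ZMod 2) : C.frame (Pi.single (.inr (i, s)) a) =
      propagate (C.gates.drop (i + 1)) (legFrame (C.gates.get i) a s) := by
  have hsplit : List.finRange C.gates.length =
      (List.finRange C.gates.length).take i ++ i :: (List.finRange C.gates.length).drop (i + 1) := by
    conv_lhs => rw [← List.take_append_drop i (List.finRange C.gates.length),
      List.drop_eq_getElem_cons (by simp)]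
    simp
  -- Distinctness of the indices makes the gates before and after `i` fault-free.
  have hnd := List.nodup_finRange C.gates.length
  rw [hsplit, List.nodup_append, List.nodup_cons] at hnd
  have hz : ∀ j, j ≠ i → ∀ s', (Pi.single (.inr (i, s)) a : C.Edge → ZMod 2 × ZMod 2)
      (.inr (j, s')) = 0 := by
    intro j hj s'
    simp [hj]
  have h0 : (fun q => (Pi.single (M := fun _ => ZMod 2 × ZMod 2) (.inr (i, s) : C.Edge) a
      (.inl q)).1, fun q => (Pi.single (M := fun _ => ZMod 2 × ZMod 2) (.inr (i, s) : C.Edge) a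
      (.inl q)).2) = (0 : Frame m) := by
    ext q <;> simp
  rw [frame, hsplit, h0, List.foldl_append, List.foldl_cons,
    foldl_stepFrame _ _ _ fun j hj => hz j fun e => hnd.2.2 j hj i (by simp) e,
    foldl_stepFrame _ _ _ fun j hj => hz j (by rintro rfl; exact hnd.2.1.1 hj), propagate_zero]
  congr 1
  · rw [List.map_drop, List.map_get_finRange]
  · rw [stepFrame, cnotFrame_zero, add_zero]
    cases s <;> simp [gateError, legFrame]

/-! Binary encodings, for evaluation. -/

/-- The position of a wire in the binary encoding. -/
def Wire.index {m : ℕ} : Wire m → ℕ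
  | .data i => i
  | .flag => 7
  | .anc j => 8 + j

lemma Wire.index_injective {m : ℕ} : Function.Injective (Wire.index (m := m)) := by
  intro w w' h
  cases w <;> cases w' <;> simp only [Wire.index] at h <;>
    first | rfl | (congr 1; ext; omega) | omega

/-- The binary digits of a number. -/
def digits {ι : Type*} (index : ι → ℕ) (n : ℕ) : ι → ZMod 2 :=
  fun w => if n.testBit (index w) then 1 else 0

/-- Addition over `ZMod 2` becomes xor of natural numbers, so effects of single-edge faults can be
evaluated by integer arithmetic. -/
lemma digits_xor {ι : Type*} (index : ι → ℕ) (n n' : ℕ) :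
    digits index (n ^^^ n') = digits index n + digits index n' := by
  ext w
  simp only [digits, Nat.testBit_xor, Pi.add_apply]
  cases n.testBit (index w) <;> cases n'.testBit (index w) <;> decide

lemma digits_zero {ι : Type*} (index : ι → ℕ) : digits index 0 = 0 := by
  ext w; simp [digits]

/-- The number with at most one nonzero bit. -/
def singleCode {m : ℕ} (w : Wire m) (a : ZMod 2) : ℕ := if a = 1 then 2 ^ w.index else 0

lemma digits_singleCode {m : ℕ} (w : Wire m) (a : ZMod 2) :
    digits Wire.index (singleCode w a) = Pi.single w a := by
  ext w'
  simp only [digits, singleCode]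
  rcases eq_zero_or_eq_one a with rfl | rfl
  · simp
  · by_cases h : w' = w
    · subst h; simp [Nat.testBit_two_pow_self]
    · have : w.index ≠ w'.index := fun e => h (Wire.index_injective e.symm)
      simp [h, Nat.testBit_two_pow_of_ne this]

/-- `cnotBits` on encodings. -/
def cnotCode {m : ℕ} (g : Wire m × Wire m) (n : ℕ) : ℕ :=
  n ^^^ bif n.testBit g.1.index then 2 ^ g.2.index else 0

lemma digits_cnotCode {m : ℕ} (g : Wire m × Wire m) (n : ℕ) :
    digits Wire.index (cnotCode g n) = cnotBits g (digits Wire.index n) := by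
  have h : (bif n.testBit g.1.index then 2 ^ g.2.index else 0) =
      singleCode g.2 (digits Wire.index n g.1) := by
    cases h : n.testBit g.1.index <;> simp [singleCode, digits, h]
  rw [cnotCode, h, digits_xor, digits_singleCode, cnotBits_eq]

/-- `propagate` on encodings. -/
def propagateCode {m : ℕ} (l : List (Wire m × Wire m)) (p : ℕ × ℕ) : ℕ × ℕ :=
  (l.foldl (fun n g => cnotCode g n) p.1, l.foldl (fun n g => cnotCode g.swap n) p.2)

lemma propagate_digits {m : ℕ} (l : List (Wire m × Wire m)) (p : ℕ × ℕ) :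
    propagate l (digits Wire.index p.1, digits Wire.index p.2) =
      (digits Wire.index (propagateCode l p).1, digits Wire.index (propagateCode l p).2) := by
  induction l generalizing p with
  | nil => rfl
  | cons g l ih =>
    have := ih (cnotCode g p.1, cnotCode g.swap p.2)
    rw [digits_cnotCode, digits_cnotCode] at this
    exact this

/-- The encoding of `Circuit.frame` for a fault on a single edge. -/
def Circuit.edgeCode {m : ℕ} (C : Circuit m) (a : ZMod 2 × ZMod 2) : C.Edge → ℕ × ℕ
  | .inl w => propagateCode C.gates (singleCode w a.1, singleCode w a.2)
  | .inr (i, .link) => propagateCode (C.gates.drop (i + 1))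
      (singleCode (C.gates.get i).2 a.1, singleCode (C.gates.get i).1 a.2)
  | .inr (i, .control) => propagateCode (C.gates.drop (i + 1))
      (singleCode (C.gates.get i).1 a.1, singleCode (C.gates.get i).1 a.2)
  | .inr (i, .target) => propagateCode (C.gates.drop (i + 1))
      (singleCode (C.gates.get i).2 a.1, singleCode (C.gates.get i).2 a.2)

lemma Circuit.frame_single {m : ℕ} (C : Circuit m) (e : C.Edge) (a : ZMod 2 × ZMod 2) :
    C.frame (Pi.single e a) =
      (digits Wire.index (C.edgeCode a e).1, digits Wire.index (C.edgeCode a e).2) := by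
  rcases e with w | ⟨i, s⟩
  · rw [frame_single_inl, edgeCode, ← propagate_digits, digits_singleCode, digits_singleCode]
  · rw [frame_single_inr]
    cases s <;> rw [edgeCode, ← propagate_digits, digits_singleCode, digits_singleCode] <;> rfl

/-! The classes of faults up to stabilizers. -/

/-- A matrix whose kernel is the row space of `parityCheck`. -/
def nullCheck : Matrix (Fin 4) (Fin 7) (ZMod 2) :=
  !![0, 0, 0, 0, 1, 1, 1;
     0, 0, 1, 1, 0, 1, 1;
     0, 1, 0, 1, 0, 1, 0;
     1, 0, 0, 1, 0, 0, 1]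

/-- Effects of faults: a class of Pauli operators on the data up to stabilizers of the measured
type, Pauli operators on the data of the other type, a flip of the syndrome, and a flip of the
flag. -/
abbrev Effect : Type := Fin (4 + 7 + 3 + 1) → ZMod 2

/-- The effect of a Pauli operator at the end of a circuit that measures checks of type `B`, in
terms of its type-`B` part `u` and its other part `v`. -/
def effectOf {m : ℕ} (R : Matrix (Fin 3) (Fin m) (ZMod 2)) (u v : Wire m → ZMod 2) : Effect :=
  Fin.append (Fin.append (Fin.append (nullCheck *ᵥ fun i => u (.data i)) fun i => v (.data i))
    (R *ᵥ fun j => v (.anc j))) fun _ => u .flag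

lemma append_add_append {k l : ℕ} (a a' : Fin k → ZMod 2) (b b' : Fin l → ZMod 2) :
    Fin.append (a + a') (b + b') = Fin.append a b + Fin.append a' b' := by
  ext i
  refine Fin.addCases (fun i => ?_) (fun i => ?_) i <;> simp

lemma effectOf_add {m : ℕ} (R : Matrix (Fin 3) (Fin m) (ZMod 2)) (u v u' v' : Wire m → ZMod 2) :
    effectOf R (u + u') (v + v') = effectOf R u v + effectOf R u' v' := by
  have h : ∀ {k l} (M : Matrix (Fin k) (Fin l) (ZMod 2)) (a b : Fin l → ZMod 2),
      (M *ᵥ fun i => a i + b i) = M *ᵥ a + M *ᵥ b := fun M a b => Matrix.mulVec_add M a b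
  simp only [effectOf, Pi.add_apply, h, ← append_add_append]
  rfl

/-- The effect of a fault as a function of its bits. -/
def Circuit.effect {m : ℕ} (C : Circuit m) (B : Basis) (R : Matrix (Fin 3) (Fin m) (ZMod 2)) :
    (C.Edge → ZMod 2 × ZMod 2) →+ Effect :=
  -- Type-`B` Pauli operators are those that flip outcomes in the other basis, so `B.swap.flip`
  -- extracts the type-`B` part.
  AddMonoidHom.mk' (fun ξ => effectOf R (B.swap.flip (C.frame ξ)) (B.flip (C.frame ξ)))
    fun ξ η => by rw [frame_add, Basis.flip_add, Basis.flip_add, effectOf_add]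

/-- Encoded effects of `Pi.single w 1` in the first argument of `effectOf`. -/
def colU {m : ℕ} : Wire m → ℕ
  -- The columns of `nullCheck`, row `i` giving bit `i`. In an encoded effect, bits 0–3 hold the
  -- class modulo stabilizers, 4–10 the other data part, 11–13 the syndrome flip and 14 the flag
  -- flip.
  | .data i => ![8, 4, 2, 14, 1, 7, 11] i
  | .anc _ => 0
  | .flag => 2 ^ 14

/-- Encoded effects of `Pi.single w 1` in the second argument of `effectOf`. -/
def colV {m : ℕ} (r : Fin m → ℕ) : Wire m → ℕ
  | .data i => 2 ^ (4 + i.val)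
  | .anc j => 2 ^ 11 * r j
  | .flag => 0

/-- The list of all wires. -/
def wires (m : ℕ) : List (Wire m) :=
  (List.finRange 7).map .data ++ (List.finRange m).map .anc ++ [.flag]

/-- The sum of the encoded columns selected by the bits of a number. -/
def combine {m : ℕ} (col : Wire m → ℕ) (n : ℕ) : ℕ :=
  (wires m).foldr (fun w k => (bif n.testBit w.index then col w else 0) ^^^ k) 0

/-- An additive map is determined by the unit vectors, so its encoded value is the xor of the
selected columns. -/
lemma digits_combine {m : ℕ} (col : Wire m → ℕ) (n : ℕ) (h : (Wire m → ZMod 2) →+ Effect)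
    (hcol : ∀ w, digits Fin.val (col w) = h (Pi.single w 1)) :
    digits Fin.val (combine col n) = h (digits Wire.index n) := by
  have key : ∀ l : List (Wire m), digits Fin.val
      (l.foldr (fun w k => (bif n.testBit w.index then col w else 0) ^^^ k) 0) =
      (l.map fun w => h (Pi.single w (digits Wire.index n w))).sum := by
    intro l
    induction l with
    | nil => exact digits_zero _
    | cons w l ih =>
      rw [List.foldr_cons, digits_xor, ih, List.map_cons, List.sum_cons, digits]
      congr 1
      cases hn : n.testBit w.index
      · simp [digits_zero]
      · simp [hcol]
  rw [combine, key, wires, List.map_append, List.map_append, List.sum_append, List.sum_append,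
    List.map_map, List.map_map, List.map_singleton, List.sum_singleton]
  conv_rhs => rw [← Finset.univ_sum_single (digits Wire.index n), map_sum, sum_wire]
  congr 2

/-- The encoded effect of a fault on a single edge. -/
def Circuit.effectCode {m : ℕ} (C : Circuit m) (B : Basis) (r : Fin m → ℕ) (a : ZMod 2 × ZMod 2)
    (e : C.Edge) : ℕ :=
  match B with
  | .X => combine (m := m) colU (C.edgeCode a e).1 ^^^ combine (colV r) (C.edgeCode a e).2
  | .Z => combine (m := m) colU (C.edgeCode a e).2 ^^^ combine (colV r) (C.edgeCode a e).1

lemma Circuit.effect_single {m : ℕ} (C : Circuit m) (B : Basis)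
    (R : Matrix (Fin 3) (Fin m) (ZMod 2)) (r : Fin m → ℕ)
    (hU : ∀ w, digits Fin.val (colU w) = effectOf R (Pi.single w 1) 0)
    (hV : ∀ w, digits Fin.val (colV r w) = effectOf R 0 (Pi.single w 1))
    (e : C.Edge) (a : ZMod 2 × ZMod 2) :
    C.effect B R (Pi.single e a) = digits Fin.val (C.effectCode B r a e) := by
  have hU' := fun n => digits_combine colU n (AddMonoidHom.mk' (fun u => effectOf R u 0)
    fun u u' => by rw [← effectOf_add, add_zero]) hU
  have hV' := fun n => digits_combine (colV r) n (AddMonoidHom.mk' (fun v => effectOf R 0 v)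
    fun u u' => by rw [← effectOf_add, add_zero]) hV
  simp only [AddMonoidHom.mk'_apply] at hU' hV'
  cases B <;> simp only [effect, AddMonoidHom.mk'_apply, effectCode, digits_xor, hU', hV',
    frame_single, Basis.swap, Basis.flip, ← effectOf_add, add_zero, zero_add]

/-! Transfer of faults between the two circuits. -/

/-- The encoded effects of the unflagged faults of weight at most one. -/
def unflagged : List ℕ :=
  [0, 1, 2, 4, 7, 8, 11, 14, 16, 24, 32, 36, 64, 66, 128, 142, 256, 257, 512, 519, 1024, 1035,
   2048, 2056, 2064, 2072, 4096, 4097, 4098, 4352, 4353, 6144, 6148, 6176, 6180, 8192, 8203, 9216,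
   9227, 10240, 10242, 10254, 10368, 10382, 12288, 12295, 12800, 12807, 14336, 14338, 14400, 14402]

/-- The encoded effects of the flagged single faults that both circuits have. -/
def flagged : List ℕ :=
  [16384, 16388, 16389, 16391, 16396, 18436, 18444, 20484, 20485, 20487, 22528, 22532, 24583, 24588,
   26624, 26636, 28672, 28679]

/-- The encoded effects of the flagged single faults of the Steane-style circuit. -/
def steaneFlagged : List ℕ := 16398 :: 26638 :: flagged

/-- The encoded effects of the flagged single faults of the optimized circuit. -/
def optimizedFlagged : List ℕ := 16386 :: 26626 :: flagged

/-- Each pair of flagged effects from the first list has the same sum as a pair of effects from the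
second list or as a pair of unflagged effects. -/
def PairsCovered (l₁ l₂ : List ℕ) : Prop :=
  ∀ n ∈ l₁, ∀ n' ∈ l₁, (n ∈ l₂ ∧ n' ∈ l₂) ∨ (∃ k ∈ unflagged, n ^^^ n' ^^^ k ∈ unflagged) ∨
    ∃ k ∈ l₂, n ^^^ n' ^^^ k ∈ l₂

instance (l₁ l₂ : List ℕ) : Decidable (PairsCovered l₁ l₂) := by
  unfold PairsCovered; infer_instance

-- Shared flagged effects are matched by themselves; only pairs containing one of the two effects
-- special to the first list need another decomposition.
set_option maxRecDepth 100000 in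
lemma pairsCovered_steane_optimized : PairsCovered steaneFlagged optimizedFlagged := by
  decide +kernel

set_option maxRecDepth 100000 in
lemma pairsCovered_optimized_steane : PairsCovered optimizedFlagged steaneFlagged := by
  decide +kernel

/-- The columns of the readout matrix of the Steane-style circuit, in binary. -/
def steaneColumns : Fin 7 → ℕ := ![1, 3, 7, 5, 2, 6, 4]

/-- The columns of the readout matrix of the optimized circuit, in binary. -/
def optimizedColumns : Fin 3 → ℕ := ![3, 7, 2]

-- Together with `exists_steane` and the analogues for `optimized`, this shows that the lists are
-- exactly the single-edge effects, for both types `B`. That `unflagged` serves both circuits is the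
-- core of the equivalence.
set_option maxRecDepth 100000 in
lemma mem_steane (B : Basis) : ∀ e a,
    (steaneStyle B).effectCode B steaneColumns a e ∈ unflagged ++ steaneFlagged := by
  cases B <;> decide +kernel

set_option maxRecDepth 100000 in
lemma mem_optimized (B : Basis) : ∀ e a,
    (optimized B).effectCode B optimizedColumns a e ∈ unflagged ++ optimizedFlagged := by
  cases B <;> decide +kernel

set_option maxRecDepth 100000 in
lemma exists_steane (B : Basis) : ∀ n ∈ unflagged ++ steaneFlagged, ∃ e a,
    (steaneStyle B).effectCode B steaneColumns a e = n := by
  cases B <;> decide +kernel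

set_option maxRecDepth 100000 in
lemma exists_optimized (B : Basis) : ∀ n ∈ unflagged ++ optimizedFlagged, ∃ e a,
    (optimized B).effectCode B optimizedColumns a e = n := by
  cases B <;> decide +kernel

set_option maxRecDepth 100000 in
lemma effect_single_steane (B : Basis) (e : (steaneStyle B).Edge) (a : ZMod 2 × ZMod 2) :
    (steaneStyle B).effect B parityCheck (Pi.single e a) =
      digits Fin.val ((steaneStyle B).effectCode B steaneColumns a e) :=
  Circuit.effect_single _ _ _ _ (by decide +kernel) (by decide +kernel) _ _

set_option maxRecDepth 100000 in
lemma effect_single_optimized (B : Basis) (e : (optimized B).Edge) (a : ZMod 2 × ZMod 2) :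
    (optimized B).effect B effectiveCheck (Pi.single e a) =
      digits Fin.val ((optimized B).effectCode B optimizedColumns a e) :=
  Circuit.effect_single _ _ _ _ (by decide +kernel) (by decide +kernel) _ _

/-- The flip of the flag in an effect. -/
def flagHom : Effect →+ ZMod 2 := Pi.evalAddMonoidHom _ (Fin.last 14)

lemma flagHom_unflagged {n : ℕ} (hn : n ∈ unflagged) : flagHom (digits Fin.val n) = 0 := by
  revert n; decide +kernel

lemma flagHom_flagged {n : ℕ} (hn : n ∈ steaneFlagged ++ optimizedFlagged) :
    flagHom (digits Fin.val n) = 1 := by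
  revert n; decide +kernel

lemma Circuit.weight_eq {m : ℕ} (C : Circuit m) (F : C.Fault) :
    C.weight F = hammingNorm (Circuit.bits F) := by
  simp only [weight, hammingNorm, Circuit.bits, ne_eq, Pauli.bits_eq_zero]

lemma hammingNorm_single_le {E A : Type*} [Fintype E] [DecidableEq E] [AddCommGroup A]
    [DecidableEq A] (e : E) (a : A) : hammingNorm (Pi.single e a : E → A) ≤ 1 := by
  refine Finset.card_le_one.2 fun i hi j hj => ?_
  have h : ∀ k, (Pi.single e a : E → A) k ≠ 0 → k = e := by
    intro k hk; by_contra hne; exact hk (by simp [hne])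
  simp only [Finset.mem_filter] at hi hj
  rw [h i hi.2, h j hj.2]

lemma hammingNorm_single_add_single_le {E A : Type*} [Fintype E] [DecidableEq E] [AddCommGroup A]
    [DecidableEq A] (e e' : E) (a a' : A) :
    hammingNorm (Pi.single e a + Pi.single e' a' : E → A) ≤ 2 := by
  refine (Finset.card_le_card (t := {e, e'}) fun i hi => ?_).trans Finset.card_le_two
  simp only [Finset.mem_filter] at hi
  by_contra h
  simp only [Finset.mem_insert, Finset.mem_singleton, not_or] at h
  exact hi.2 (by simp [h.1, h.2])

/-- This feeds the finite checks into `exists_hammingNorm_le`: unflagged effects are matched by one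
edge, sums of two flagged effects by at most two. -/
lemma exists_fault {m₁ m₂ : ℕ} (C₁ : Circuit m₁) (C₂ : Circuit m₂) (B : Basis)
    (R₁ : Matrix (Fin 3) (Fin m₁) (ZMod 2)) (R₂ : Matrix (Fin 3) (Fin m₂) (ZMod 2))
    (code₁ : ZMod 2 × ZMod 2 → C₁.Edge → ℕ) (code₂ : ZMod 2 × ZMod 2 → C₂.Edge → ℕ)
    (h₁ : ∀ e a, C₁.effect B R₁ (Pi.single e a) = digits Fin.val (code₁ a e))
    (h₂ : ∀ e a, C₂.effect B R₂ (Pi.single e a) = digits Fin.val (code₂ a e))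
    {l₁ l₂ : List ℕ} (hl₁ : l₁ ⊆ steaneFlagged ++ optimizedFlagged)
    (hmem : ∀ e a, code₁ a e ∈ unflagged ++ l₁)
    (hex : ∀ n ∈ unflagged ++ l₂, ∃ e a, code₂ a e = n)
    (hpairs : PairsCovered l₁ l₂) (F₁ : C₁.Fault)
    (hF : flagHom (C₁.effect B R₁ (Circuit.bits F₁)) = 0) :
    ∃ F₂ : C₂.Fault, C₂.weight F₂ ≤ C₁.weight F₁ ∧
      C₂.effect B R₂ (Circuit.bits F₂) = C₁.effect B R₁ (Circuit.bits F₁) := by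
  have hpair : ∀ n ∈ unflagged ++ l₂, ∀ n' ∈ unflagged ++ l₂, ∃ η, hammingNorm η ≤ 2 ∧
      C₂.effect B R₂ η = digits Fin.val (n ^^^ n') := by
    intro n hn n' hn'
    obtain ⟨e, a, rfl⟩ := hex n hn
    obtain ⟨e', a', rfl⟩ := hex n' hn'
    exact ⟨_, hammingNorm_single_add_single_le e e' a a', by rw [map_add, h₂, h₂, digits_xor]⟩
  have hself : ∀ v : Effect, v + v = 0 := fun v => by ext i; exact CharTwo.add_self_eq_zero _
  have hsingle : ∀ e a, flagHom (C₁.effect B R₁ (Pi.single e a)) = 0 →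
      ∃ η, hammingNorm η ≤ 1 ∧ C₂.effect B R₂ η = C₁.effect B R₁ (Pi.single e a) := by
    intro e a h0
    have hu : code₁ a e ∈ unflagged := by
      refine (List.mem_append.1 (hmem e a)).resolve_right fun h => ?_
      rw [h₁, flagHom_flagged (hl₁ h)] at h0
      exact one_ne_zero h0
    obtain ⟨e', a', h⟩ := hex _ (List.mem_append_left _ hu)
    exact ⟨_, hammingNorm_single_le e' a', by rw [h₁, h₂, h]⟩
  have hdouble : ∀ e a e' a', flagHom (C₁.effect B R₁ (Pi.single e a)) = 1 →
      flagHom (C₁.effect B R₁ (Pi.single e' a')) = 1 → ∃ η, hammingNorm η ≤ 2 ∧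
      C₂.effect B R₂ η = C₁.effect B R₁ (Pi.single e a) + C₁.effect B R₁ (Pi.single e' a') := by
    intro e a e' a' h0 h0'
    have hfl : ∀ e a, flagHom (C₁.effect B R₁ (Pi.single e a)) = 1 → code₁ a e ∈ l₁ := by
      intro e a h0
      refine (List.mem_append.1 (hmem e a)).resolve_left fun h => ?_
      rw [h₁, flagHom_unflagged h] at h0
      exact zero_ne_one h0
    rw [h₁, h₁, ← digits_xor]
    have hcancel : ∀ n k : ℕ, k ^^^ (n ^^^ k) = n := fun n k => by
      rw [Nat.xor_comm n, ← Nat.xor_assoc, Nat.xor_self, Nat.zero_xor]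
    rcases hpairs _ (hfl _ _ h0) _ (hfl _ _ h0') with ⟨h, h'⟩ | ⟨k, hk, h⟩ | ⟨k, hk, h⟩
    · exact hpair _ (List.mem_append_right _ h) _ (List.mem_append_right _ h')
    · have := hpair _ (List.mem_append_left _ hk) _ (List.mem_append_left _ h)
      rwa [hcancel] at this
    · have := hpair _ (List.mem_append_right _ hk) _ (List.mem_append_right _ h)
      rwa [hcancel] at this
  obtain ⟨η, hη, hη'⟩ := exists_hammingNorm_le (C₁.effect B R₁) (C₂.effect B R₂) flagHom hself
    hsingle hdouble (Circuit.bits F₁) hF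
  have hbits : Circuit.bits (C := C₂) (fun e => .ofBits (η e)) = η :=
    funext fun e => Pauli.bits_ofBits _
  exact ⟨fun e => .ofBits (η e), by rwa [Circuit.weight_eq, Circuit.weight_eq, hbits],
    by rwa [hbits]⟩

/-! Entries of the syndrome projectors. -/

/-- The operator `X^v` on the data. -/
def shiftOp (v : Fin 7 → ZMod 2) : DataOp := Matrix.of fun y x => if x = y + v then 1 else 0

lemma shiftOp_zero : shiftOp 0 = 1 := by
  ext y x; simp [shiftOp, Matrix.one_apply, eq_comm]

lemma shiftOp_mul (u v : Fin 7 → ZMod 2) : shiftOp u * shiftOp v = shiftOp (u + v) := by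
  ext y x
  simp only [shiftOp, Matrix.mul_apply, Matrix.of_apply]
  rw [Finset.sum_eq_single (y + u)]
  · simp [add_assoc]
  · intro j _ hj; simp [hj]
  · simp

lemma stabilizer_X (i : Fin 3) : stabilizer .X i = shiftOp (parityCheck i) := by
  ext y x
  have h : ∀ q, (if parityCheck i q = 1 then Basis.X.pauli else Pauli.I).mat (y q) (x q) =
      if x q = y q + parityCheck i q then 1 else 0 := by
    intro q
    rcases eq_zero_or_eq_one (parityCheck i q) with h | h
    · simp [h, Pauli.mat_eq, Pauli.phase, Pauli.bits]
    · rw [if_pos h, h, Pauli.mat_eq]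
      simp only [Basis.pauli, Pauli.phase, Pauli.bits, zero_mul, sgn_zero, one_mul]
      exact if_congr Iff.rfl rfl rfl
  simp only [stabilizer, pauliString, Matrix.of_apply, h, shiftOp, Finset.prod_ite_zero,
    Finset.prod_const_one, funext_iff, Pi.add_apply, Finset.mem_univ, true_imp_iff]

lemma stabilizer_Z (i : Fin 3) :
    stabilizer .Z i = Matrix.diagonal fun y => sgn ((parityCheck *ᵥ y) i) := by
  ext y x
  have h : ∀ q, (if parityCheck i q = 1 then Basis.Z.pauli else Pauli.I).mat (y q) (x q) =
      sgn (parityCheck i q * y q) * if x q = y q then 1 else 0 := by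
    intro q
    rcases eq_zero_or_eq_one (parityCheck i q) with h | h <;>
      simp [h, Basis.pauli, Pauli.mat_eq, Pauli.phase, Pauli.bits]
  simp only [stabilizer, pauliString, Matrix.of_apply, h, Finset.prod_mul_distrib, ← sgn_sum,
    Finset.prod_ite_zero, Finset.prod_const_one, Finset.mem_univ, true_imp_iff,
    Matrix.diagonal_apply, Matrix.mulVec, dotProduct]
  by_cases hyx : y = x
  · simp [hyx]
  · rw [if_neg hyx, if_neg fun hh => hyx (funext hh).symm, mul_zero]

lemma sgn_eq (a : ZMod 2) : (if a = 0 then (1 : ℂ) else -1) = sgn a := rfl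

lemma syndromeProj_Z (s : Fin 3 → ZMod 2) (y x : Fin 7 → ZMod 2) :
    syndromeProj .Z s y x = if y = x ∧ parityCheck *ᵥ y = s then 1 else 0 := by
  have h : ∀ a b : ZMod 2, 2⁻¹ * (1 + sgn a * sgn b) = if b = a then (1 : ℂ) else 0 := by
    intro a b
    rcases eq_zero_or_eq_one a with rfl | rfl <;> rcases eq_zero_or_eq_one b with rfl | rfl <;>
      simp <;> norm_num
  have hd : ∀ i, ((1 / 2 : ℂ) • (1 + (if s i = 0 then (1 : ℂ) else -1) • stabilizer .Z i)) =
      Matrix.diagonal fun y => if (parityCheck *ᵥ y) i = s i then (1 : ℂ) else 0 := by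
    intro i
    ext y x
    rw [stabilizer_Z, sgn_eq]
    by_cases hyx : y = x
    · subst hyx; simp [h]
    · simp [hyx]
  simp only [syndromeProj, hd]
  simp only [List.finRange_succ, List.finRange_zero, List.map_cons, List.map_nil, List.prod_cons,
    List.prod_nil, mul_one, Matrix.diagonal_mul_diagonal, Matrix.diagonal_apply]
  have hs : parityCheck *ᵥ y = s ↔ (parityCheck *ᵥ y) 0 = s 0 ∧ (parityCheck *ᵥ y) 1 = s 1 ∧
      (parityCheck *ᵥ y) 2 = s 2 := by
    rw [funext_iff]; simp [Fin.forall_fin_succ]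
  simp only [hs, ite_and, ite_mul, one_mul, zero_mul]
  rfl

/-- The representation of a codeword by the rows of `parityCheck`. -/
lemma row_combination_eq_iff : ∀ (v : Fin 7 → ZMod 2) (c₀ c₁ c₂ : ZMod 2),
    v = c₀ • parityCheck 0 + (c₁ • parityCheck 1 + c₂ • parityCheck 2) ↔
      nullCheck *ᵥ v = 0 ∧ c₀ = v 0 ∧ c₁ = v 4 ∧ c₂ = v 6 := by
  decide +kernel

/-- Columns 0, 4 and 6 of `parityCheck` are the unit vectors, so the coefficients of a combination
of rows are its entries there. -/
lemma nullCheck_eq_zero {v : Fin 7 → ZMod 2} (hv : nullCheck *ᵥ v = 0) :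
    v = v 0 • parityCheck 0 + (v 4 • parityCheck 1 + v 6 • parityCheck 2) :=
  (row_combination_eq_iff v _ _ _).2 ⟨hv, rfl, rfl, rfl⟩

/-- Expanding the product of the `(1 ± S) / 2` gives an average over the eight stabilizers `X^v`,
and the entry at `(y, x)` sees only `v = x + y`. Writing the syndrome as `parityCheck *ᵥ b` turns
the sign of `X^v` into the character `b ⬝ᵥ v`. -/
lemma syndromeProj_X (b y x : Fin 7 → ZMod 2) :
    syndromeProj .X (parityCheck *ᵥ b) y x =
      if nullCheck *ᵥ (x + y) = 0 then 8⁻¹ * sgn (b ⬝ᵥ (x + y)) else 0 := by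
  set s := parityCheck *ᵥ b with hs
  have h : ∀ i, ((1 / 2 : ℂ) • (1 + (if s i = 0 then (1 : ℂ) else -1) • stabilizer .X i)) =
      ∑ c : ZMod 2, (2⁻¹ * sgn (c * s i)) • shiftOp (c • parityCheck i) := by
    intro i
    have : (Finset.univ : Finset (ZMod 2)) = {0, 1} := rfl
    rw [this, Finset.sum_pair (by decide), stabilizer_X, sgn_eq]
    simp [shiftOp_zero, smul_smul]
  have hx : ∀ v, x = y + v ↔ x + y = v := by
    intro v; constructor
    · rintro rfl; rw [add_right_comm, CharTwo.add_self_eq_zero, zero_add]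
    · rintro rfl; rw [add_left_comm, CharTwo.add_self_eq_zero, add_zero]
  have hprod : syndromeProj .X s = ∑ c₂ : ZMod 2, ∑ c₁ : ZMod 2, ∑ c₀ : ZMod 2,
      (8⁻¹ * sgn (c₀ * s 0 + (c₁ * s 1 + c₂ * s 2))) •
        shiftOp (c₀ • parityCheck 0 + (c₁ • parityCheck 1 + c₂ • parityCheck 2)) := by
    simp only [syndromeProj, h]
    simp only [List.finRange_succ, List.finRange_zero, List.map_cons, List.map_nil,
      List.prod_cons, List.prod_nil, mul_one, Finset.sum_mul, Finset.mul_sum,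
      smul_mul_smul_comm, shiftOp_mul]
    refine Finset.sum_congr rfl fun c₂ _ => Finset.sum_congr rfl fun c₁ _ =>
      Finset.sum_congr rfl fun c₀ _ => ?_
    rw [sgn_add, sgn_add]
    congr 1
    simp only [Fin.succ_zero_eq_one, Fin.succ_one_eq_two]
    ring
  rw [hprod]
  simp only [Matrix.sum_apply, Matrix.smul_apply, shiftOp, Matrix.of_apply, smul_eq_mul, hx,
    row_combination_eq_iff]
  by_cases hv : nullCheck *ᵥ (x + y) = 0
  · have hdot : b ⬝ᵥ (x + y) =
        (x + y) 0 * s 0 + ((x + y) 4 * s 1 + (x + y) 6 * s 2) := by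
      conv_lhs => rw [nullCheck_eq_zero hv]
      simp only [dotProduct_add, dotProduct_smul, smul_eq_mul, hs, Matrix.mulVec]
      simp only [dotProduct_comm b]
    rw [hdot]
    simp [hv, ite_and]
  · simp [hv]

/-! Kraus operators of the circuits without faults. -/

/-- Gates act by precomposition, so the last gate is the first to transform the output bits; hence
`foldr`. -/
lemma Circuit.runIdeal_apply {m : ℕ} (C : Circuit m) (ψ : State m) (y : Wire m → ZMod 2) :
    C.runIdeal ψ y = ψ (C.gates.foldr cnotBits y) := by
  have h : ∀ (l : List (Wire m × Wire m)) (ψ : State m) (y : Wire m → ZMod 2),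
      l.foldl (fun ψ g => cnot g ψ) ψ y = ψ (l.foldr cnotBits y) := by
    intro l
    induction l with
    | nil => intro ψ y; rfl
    | cons g l ih => intro ψ y; rw [List.foldl_cons, ih]; rfl
  have := h ((List.finRange C.gates.length).map C.gates.get) ψ y
  rw [List.foldl_map, List.map_get_finRange] at this
  exact this

lemma Circuit.input_join {m : ℕ} (C : Circuit m) (x y : Fin 7 → ZMod 2) (a : Fin m → ZMod 2)
    (g : ZMod 2) : C.input x (join y a g) =
      if y = x then (∏ j, (C.prepAnc j).ket 0 (a j)) * C.prepFlag.ket 0 g else 0 := rfl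

lemma steaneStyleX_foldr (y a : Fin 7 → ZMod 2) (g : ZMod 2) :
    steaneStyleX.gates.foldr cnotBits (join y a g) = join (y + a)
      ![a 0, a 1 + a 4 + a 0, a 2 + a 3 + a 4, a 3 + a 0 + a 6, a 4, a 5 + a 6 + a 4, a 6]
      (g + a 3 + a 1 + a 5) := by
  ext w
  rcases w with i | j | _
  · fin_cases i <;> rfl
  · fin_cases j <;> rfl
  · rfl

lemma steaneStyleZ_foldr (y a : Fin 7 → ZMod 2) (g : ZMod 2) :
    steaneStyleX.dual.gates.foldr cnotBits (join y a g) = join y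
      ![a 0 + y 0 + (a 3 + y 3 + g + (a 2 + y 2)) + (a 1 + y 1 + g), a 1 + y 1 + g, a 2 + y 2,
        a 3 + y 3 + g + (a 2 + y 2),
        a 4 + y 4 + (a 1 + y 1 + g) + (a 2 + y 2) + (a 5 + y 5 + g), a 5 + y 5 + g,
        a 6 + y 6 + (a 5 + y 5 + g) + (a 3 + y 3 + g + (a 2 + y 2))] g := by
  ext w
  rcases w with i | j | _
  · fin_cases i <;> rfl
  · fin_cases j <;> rfl
  · rfl

lemma optimizedX_foldr (y : Fin 7 → ZMod 2) (a : Fin 3 → ZMod 2) (g : ZMod 2) :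
    optimizedX.gates.foldr cnotBits (join y a g) = join
      (y + ![a 0 + a 2, a 0, a 1, a 1 + a 2, a 2, a 2 + (a 1 + a 2 + (a 0 + a 2)),
        a 1 + a 2 + (a 0 + a 2)])
      ![a 0 + a 2, a 1 + a 2 + (a 0 + a 2), a 2 + (a 1 + a 2 + (a 0 + a 2))]
      (g + a 0 + (a 1 + a 2) + (a 2 + (a 1 + a 2 + (a 0 + a 2)))) := by
  ext w
  rcases w with i | j | _
  · fin_cases i <;> rfl
  · fin_cases j <;> rfl
  · rfl

lemma optimizedZ_foldr (y : Fin 7 → ZMod 2) (a : Fin 3 → ZMod 2) (g : ZMod 2) :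
    optimizedX.dual.gates.foldr cnotBits (join y a g) = join y
      ![a 0 + y 1 + g + y 0 + (a 1 + y 2 + g + y 3),
        a 1 + y 2 + g + y 3 + y 6 + (a 2 + y 4 + (a 0 + y 1 + g) + (a 1 + y 2)),
        a 2 + y 4 + (a 0 + y 1 + g) + (a 1 + y 2) + g + y 5] g := by
  ext w
  rcases w with i | j | _
  · fin_cases i <;> rfl
  · fin_cases j <;> rfl
  · rfl

/-- The amplitude `1 / √2`. -/
noncomputable def invSqrtTwo : ℂ := ((Real.sqrt 2 : ℝ) : ℂ)⁻¹

lemma invSqrtTwo_sq : invSqrtTwo ^ 2 = 2⁻¹ := by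
  rw [invSqrtTwo, inv_pow, ← Complex.ofReal_pow, Real.sq_sqrt (by norm_num)]
  norm_num

lemma Basis.ket_X' (b a : ZMod 2) : Basis.X.ket b a = invSqrtTwo * sgn (b * a) := by
  rw [Basis.ket_X, invSqrtTwo, div_eq_inv_mul]

lemma Basis.ket_X_zero (a : ZMod 2) : Basis.X.ket 0 a = invSqrtTwo := by
  rw [Basis.ket_X', zero_mul, sgn_zero, mul_one]

lemma Basis.ket_Z (b a : ZMod 2) : Basis.Z.ket b a = if a = b then 1 else 0 := rfl

lemma add_eq_iff_eq_add {n : ℕ} (y a x : Fin n → ZMod 2) : y + a = x ↔ a = x + y := by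
  have h : y + y = 0 := funext fun i => CharTwo.add_self_eq_zero (y i)
  have h' : a + a = 0 := funext fun i => CharTwo.add_self_eq_zero (a i)
  constructor
  · rintro rfl; rw [add_right_comm, h, zero_add]
  · rintro rfl; rw [add_left_comm, h, add_zero]

lemma prod_ket_X {m : ℕ} (b a : Fin m → ZMod 2) :
    ∏ j, Basis.X.ket (b j) (a j) = invSqrtTwo ^ m * sgn (b ⬝ᵥ a) := by
  simp only [Basis.ket_X', Finset.prod_mul_distrib, Finset.prod_const, Finset.card_univ,
    Fintype.card_fin, dotProduct, sgn_sum]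

lemma prod_ket_Z {m : ℕ} (b a : Fin m → ZMod 2) :
    ∏ j, Basis.Z.ket (b j) (a j) = if a = b then 1 else 0 := by
  simp only [Basis.ket_Z, Finset.prod_ite_zero, Finset.prod_const_one, Finset.mem_univ,
    true_imp_iff, funext_iff]

lemma sum_zmod_two {M : Type*} [AddCommMonoid M] (h : ZMod 2 → M) : ∑ g, h g = h 0 + h 1 := by
  have : (Finset.univ : Finset (ZMod 2)) = {0, 1} := rfl
  rw [this, Finset.sum_pair (by decide)]

/-- The left side says that the ancillas prepared in `|0⟩` pull back to bit 0. Goto's circuit thus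
yields the uniform superposition over the row space of `parityCheck`, which is the logical `|0⟩`. -/
lemma steane_conditions_iff : ∀ v : Fin 7 → ZMod 2,
    (v 1 + v 4 + v 0 = 0 ∧ v 2 + v 3 + v 4 = 0 ∧ v 3 + v 0 + v 6 = 0 ∧ v 5 + v 6 + v 4 = 0) ↔
      nullCheck *ᵥ v = 0 := by
  decide +kernel

/-- The flag measures `Z` on ancillas 1, 3 and 5, a logical `Z` operator of weight three, which
fixes the logical `|0⟩`. -/
lemma nullCheck_flag : ∀ v : Fin 7 → ZMod 2, nullCheck *ᵥ v = 0 → v 3 + v 1 + v 5 = 0 := by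
  decide +kernel

/-- The transversal CNOT forces the ancilla bits to be `x + y`, the preparation restricts them to
the row space, and the `X` measurements supply the character. Ten factors `1 / √2` (seven
measurements, three `|+⟩`) give `32⁻¹ = 4⁻¹ * 8⁻¹`. -/
lemma kraus_steaneStyleX (b : Fin 7 → ZMod 2) (f : ZMod 2) :
    steaneStyleX.kraus steaneStyleX.noFault b f =
      (if f = 0 then 4⁻¹ else 0 : ℂ) • syndromeProj .X (parityCheck *ᵥ b) := by
  ext y x
  have hprep : ∀ a : Fin 7 → ZMod 2, ∏ j, (steaneStyleX.prepAnc j).ket 0 (a j) =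
      invSqrtTwo ^ 3 * if a 1 = 0 ∧ a 2 = 0 ∧ a 3 = 0 ∧ a 5 = 0 then 1 else 0 := by
    intro a
    rw [Fin.prod_univ_seven]
    change Basis.X.ket 0 (a 0) * Basis.Z.ket 0 (a 1) * Basis.Z.ket 0 (a 2) * Basis.Z.ket 0 (a 3) *
      Basis.X.ket 0 (a 4) * Basis.Z.ket 0 (a 5) * Basis.X.ket 0 (a 6) = _
    simp only [Basis.ket_X_zero, Basis.ket_Z, ite_and, mul_ite, ite_mul, mul_one, mul_zero,
      zero_mul]
    split_ifs <;> ring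
  have e1 : ∀ a, ∏ j, (steaneStyleX.measAnc j).ket (b j) (a j) =
    invSqrtTwo ^ 7 * sgn (b ⬝ᵥ a) := fun a => prod_ket_X b a
  have e2 : ∀ g, steaneStyleX.measFlag.ket f g = if g = f then 1 else 0 := fun _ => rfl
  have e3 : ∀ g, steaneStyleX.prepFlag.ket 0 g = if g = 0 then 1 else 0 := fun _ => rfl
  rw [Circuit.kraus_noFault _ (by decide +kernel)]
  simp only [Circuit.runIdeal_apply, steaneStyleX_foldr, Circuit.input_join, hprep, e1, e2, e3,
    add_eq_iff_eq_add]
  rw [Finset.sum_eq_single (x + y) (fun a _ ha => by simp [ha]) (by simp),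
    Finset.sum_eq_single f (fun g _ hg => by simp [hg]) (by simp), Matrix.smul_apply,
    syndromeProj_X]
  generalize x + y = v
  simp only [Matrix.cons_val, steane_conditions_iff]
  by_cases hv : nullCheck *ᵥ v = 0
  · have h32 : invSqrtTwo ^ 7 * invSqrtTwo ^ 3 = 32⁻¹ := by
      rw [← pow_add, show 7 + 3 = 2 * 5 by rfl, pow_mul, invSqrtTwo_sq]; norm_num
    have hflag : f + v 3 + v 1 + v 5 = f := by
      rw [add_assoc, add_assoc, ← add_assoc (v 3), nullCheck_flag v hv, add_zero]
    simp only [if_true, if_pos hv, hflag, smul_eq_mul]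
    split_ifs
    · linear_combination sgn (b ⬝ᵥ v) * h32
    · ring
  · simp [hv]

lemma parityCheck_eq_zero_iff : ∀ v : Fin 7 → ZMod 2, parityCheck *ᵥ v = 0 ↔
    v 0 + v 1 + v 2 + v 3 = 0 ∧ v 1 + v 2 + v 4 + v 5 = 0 ∧ v 2 + v 3 + v 5 + v 6 = 0 := by
  decide +kernel

lemma parityCheck_eq_iff (u v : Fin 7 → ZMod 2) : parityCheck *ᵥ u = parityCheck *ᵥ v ↔
    u 0 + v 0 + (u 1 + v 1) + (u 2 + v 2) + (u 3 + v 3) = 0 ∧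
      u 1 + v 1 + (u 2 + v 2) + (u 4 + v 4) + (u 5 + v 5) = 0 ∧
      u 2 + v 2 + (u 3 + v 3) + (u 5 + v 5) + (u 6 + v 6) = 0 := by
  rw [← CharTwo.add_eq_zero (R := Fin 3 → ZMod 2), ← Matrix.mulVec_add, parityCheck_eq_zero_iff]
  rfl

/-- The measurement fixes the ancilla bits to `b`, and the ancillas prepared in `|0⟩` then enforce
the syndrome. Summing over the flag bit gives 2 for `f = 0` and cancels for `f = 1`. -/
lemma kraus_steaneStyleZ (b : Fin 7 → ZMod 2) (f : ZMod 2) :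
    steaneStyleX.dual.kraus steaneStyleX.dual.noFault b f =
      (if f = 0 then 4⁻¹ else 0 : ℂ) • syndromeProj .Z (parityCheck *ᵥ b) := by
  ext y x
  have hprep : ∀ a : Fin 7 → ZMod 2, ∏ j, (steaneStyleX.dual.prepAnc j).ket 0 (a j) =
      invSqrtTwo ^ 4 * if a 0 = 0 ∧ a 4 = 0 ∧ a 6 = 0 then 1 else 0 := by
    intro a
    rw [Fin.prod_univ_seven]
    change Basis.Z.ket 0 (a 0) * Basis.X.ket 0 (a 1) * Basis.X.ket 0 (a 2) * Basis.X.ket 0 (a 3) *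
      Basis.Z.ket 0 (a 4) * Basis.X.ket 0 (a 5) * Basis.Z.ket 0 (a 6) = _
    simp only [Basis.ket_X_zero, Basis.ket_Z, ite_and, mul_ite, ite_mul, mul_one, mul_zero,
      zero_mul, one_mul]
    split_ifs <;> ring
  have e1 : ∀ a, ∏ j, (steaneStyleX.dual.measAnc j).ket (b j) (a j) =
    if a = b then 1 else 0 := fun a => prod_ket_Z b a
  have e2 : ∀ g, steaneStyleX.dual.measFlag.ket f g = invSqrtTwo * sgn (f * g) := Basis.ket_X' f
  have e3 : ∀ g, steaneStyleX.dual.prepFlag.ket 0 g = invSqrtTwo := Basis.ket_X_zero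
  -- The flag bit enters each condition twice and drops out.
  have hc : ∀ g,
      (b 0 + y 0 + (b 3 + y 3 + g + (b 2 + y 2)) + (b 1 + y 1 + g) = 0 ∧
        b 4 + y 4 + (b 1 + y 1 + g) + (b 2 + y 2) + (b 5 + y 5 + g) = 0 ∧
        b 6 + y 6 + (b 5 + y 5 + g) + (b 3 + y 3 + g + (b 2 + y 2)) = 0) ↔
      parityCheck *ᵥ y = parityCheck *ᵥ b := by
    intro g
    have hg : g + g = 0 := CharTwo.add_self_eq_zero g
    rw [parityCheck_eq_iff]
    grind
  rw [Circuit.kraus_noFault _ (by decide +kernel)]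
  simp only [Circuit.runIdeal_apply, steaneStyleZ_foldr, Circuit.input_join, hprep, e1, e2, e3]
  rw [Finset.sum_eq_single b (fun a _ ha => by simp [ha]) (by simp), sum_zmod_two,
    Matrix.smul_apply, syndromeProj_Z]
  have h8 : invSqrtTwo ^ 6 = 8⁻¹ := by
    rw [pow_mul invSqrtTwo 2 3, invSqrtTwo_sq]; norm_num
  simp only [Matrix.cons_val, hc]
  by_cases hyx : y = x ∧ parityCheck *ᵥ y = parityCheck *ᵥ b
  · rw [if_pos hyx, if_pos hyx.1, if_pos hyx.2]
    rcases eq_zero_or_eq_one f with rfl | rfl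
    · simp only [zero_mul, sgn_zero, if_true, smul_eq_mul]
      linear_combination 2 * h8
    · simp
  · rw [if_neg hyx]
    by_cases h : y = x
    · rw [if_neg fun h' => hyx ⟨h, h'⟩]; simp
    · simp [h]

/-- Coordinates 1, 2 and 4 form an information set of the row space: the circuit extends the three
ancilla bits to the codeword with these entries and adds it to the data. -/
lemma optimized_conditions_iff : ∀ (v : Fin 7 → ZMod 2) (a : Fin 3 → ZMod 2),
    ![a 0 + a 2, a 0, a 1, a 1 + a 2, a 2, a 2 + (a 1 + a 2 + (a 0 + a 2)),
        a 1 + a 2 + (a 0 + a 2)] = v ↔ nullCheck *ᵥ v = 0 ∧ a = ![v 1, v 2, v 4] := by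
  decide +kernel

/-- Reading out three outcomes with `effectiveCheck` amounts to setting the other four Steane
outcomes to 0, so the entry formulas for `parityCheck *ᵥ b` apply. -/
lemma exists_parityCheck_eq : ∀ b : Fin 3 → ZMod 2,
    effectiveCheck *ᵥ b = parityCheck *ᵥ ![0, b 0, b 1, 0, b 2, 0, 0] := by
  decide +kernel

lemma kraus_optimizedX (b : Fin 3 → ZMod 2) (f : ZMod 2) :
    optimizedX.kraus optimizedX.noFault b f =
      (if f = 0 then 1 else 0 : ℂ) • syndromeProj .X (effectiveCheck *ᵥ b) := by
  ext y x
  have hprep : ∀ a : Fin 3 → ZMod 2, ∏ j, (optimizedX.prepAnc j).ket 0 (a j) =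
      invSqrtTwo ^ 3 := by
    intro a
    rw [Fin.prod_univ_three]
    change Basis.X.ket 0 (a 0) * Basis.X.ket 0 (a 1) * Basis.X.ket 0 (a 2) = _
    simp only [Basis.ket_X_zero]; ring
  have e1 : ∀ a, ∏ j, (optimizedX.measAnc j).ket (b j) (a j) =
    invSqrtTwo ^ 3 * sgn (b ⬝ᵥ a) := fun a => prod_ket_X b a
  have e2 : ∀ g, optimizedX.measFlag.ket f g = if g = f then 1 else 0 := fun _ => rfl
  have e3 : ∀ g, optimizedX.prepFlag.ket 0 g = if g = 0 then 1 else 0 := fun _ => rfl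
  rw [Circuit.kraus_noFault _ (by decide +kernel)]
  simp only [Circuit.runIdeal_apply, optimizedX_foldr, Circuit.input_join, hprep, e1, e2, e3,
    add_eq_iff_eq_add, optimized_conditions_iff]
  -- The three CNOTs onto the flag have total parity zero.
  have hg : ∀ (a : Fin 3 → ZMod 2) (g : ZMod 2),
      g + a 0 + (a 1 + a 2) + (a 2 + (a 1 + a 2 + (a 0 + a 2))) = g := by
    decide +kernel
  simp only [hg]
  rw [exists_parityCheck_eq, Matrix.smul_apply, syndromeProj_X]
  generalize x + y = v
  by_cases hv : nullCheck *ᵥ v = 0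
  · have h8 : invSqrtTwo ^ 3 * invSqrtTwo ^ 3 = 8⁻¹ := by
      rw [← pow_add, show 3 + 3 = 2 * 3 by rfl, pow_mul, invSqrtTwo_sq]; norm_num
    have hdot : (![0, b 0, b 1, 0, b 2, 0, 0] : Fin 7 → ZMod 2) ⬝ᵥ v = b ⬝ᵥ ![v 1, v 2, v 4] := by
      simp [dotProduct, Fin.sum_univ_seven, Fin.sum_univ_three]
    rw [Finset.sum_eq_single ![v 1, v 2, v 4] (fun a _ ha => by simp [ha]) (by simp),
      Finset.sum_eq_single f (fun g _ hg => by simp [hg]) (by simp), if_pos rfl,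
      if_pos ⟨hv, rfl⟩, if_pos hv, hdot, smul_eq_mul]
    split_ifs
    · linear_combination sgn (b ⬝ᵥ ![v 1, v 2, v 4]) * h8
    · ring
  · simp [hv]

lemma kraus_optimizedZ (b : Fin 3 → ZMod 2) (f : ZMod 2) :
    optimizedX.dual.kraus optimizedX.dual.noFault b f =
      (if f = 0 then 1 else 0 : ℂ) • syndromeProj .Z (effectiveCheck *ᵥ b) := by
  ext y x
  have hprep : ∀ a : Fin 3 → ZMod 2, ∏ j, (optimizedX.dual.prepAnc j).ket 0 (a j) =
      if a = 0 then 1 else 0 := fun a => prod_ket_Z 0 a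
  have e1 : ∀ a, ∏ j, (optimizedX.dual.measAnc j).ket (b j) (a j) =
    if a = b then 1 else 0 := fun a => prod_ket_Z b a
  have e2 : ∀ g, optimizedX.dual.measFlag.ket f g = invSqrtTwo * sgn (f * g) := Basis.ket_X' f
  have e3 : ∀ g, optimizedX.dual.prepFlag.ket 0 g = invSqrtTwo := Basis.ket_X_zero
  have hc : ∀ g,
      (![b 0 + y 1 + g + y 0 + (b 1 + y 2 + g + y 3),
        b 1 + y 2 + g + y 3 + y 6 + (b 2 + y 4 + (b 0 + y 1 + g) + (b 1 + y 2)),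
        b 2 + y 4 + (b 0 + y 1 + g) + (b 1 + y 2) + g + y 5] : Fin 3 → ZMod 2) = 0 ↔
      parityCheck *ᵥ y = effectiveCheck *ᵥ b := by
    intro g
    have hg : g + g = 0 := CharTwo.add_self_eq_zero g
    rw [exists_parityCheck_eq, parityCheck_eq_iff, funext_iff, Fin.forall_fin_succ,
      Fin.forall_fin_two]
    simp only [Matrix.cons_val, Pi.zero_apply, Fin.succ_zero_eq_one, Fin.succ_one_eq_two]
    grind
  rw [Circuit.kraus_noFault _ (by decide +kernel)]
  simp only [Circuit.runIdeal_apply, optimizedZ_foldr, Circuit.input_join, hprep, e1, e2, e3]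
  rw [Finset.sum_eq_single b (fun a _ ha => by simp [ha]) (by simp), sum_zmod_two,
    Matrix.smul_apply, syndromeProj_Z]
  simp only [hc]
  by_cases hyx : y = x ∧ parityCheck *ᵥ y = effectiveCheck *ᵥ b
  · rw [if_pos hyx, if_pos hyx.1, if_pos hyx.2]
    rcases eq_zero_or_eq_one f with rfl | rfl
    · simp only [zero_mul, sgn_zero, if_true, smul_eq_mul]
      linear_combination 2 * invSqrtTwo_sq
    · simp
  · rw [if_neg hyx]
    by_cases h : y = x
    · rw [if_neg fun h' => hyx ⟨h, h'⟩]; simp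
    · simp [h]

/-! Behaviour of faulty syndrome extraction circuits. -/

/-- The product of a Pauli operator on the data and a syndrome projector of type `B`, where `u` is
the type-`B` part of the Pauli operator and `v` is its other part. -/
noncomputable def pauliProj (B : Basis) (u v : Fin 7 → ZMod 2) (s : Fin 3 → ZMod 2) : DataOp :=
  match B with
  | .X => Matrix.of fun y x => sgn (v ⬝ᵥ y) * syndromeProj .X s (y + u) x
  | .Z => Matrix.of fun y x => sgn (u ⬝ᵥ y) * syndromeProj .Z s (y + v) x

lemma exists_parityCheck_mulVec_eq : ∀ s : Fin 3 → ZMod 2, ∃ b, parityCheck *ᵥ b = s := by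
  intro s
  have h : ∀ s : Fin 3 → ZMod 2,
      parityCheck *ᵥ (![s 0, 0, 0, 0, s 1, 0, s 2] : Fin 7 → ZMod 2) = s := by
    decide +kernel
  exact ⟨_, h s⟩

/-- Stabilizers act on the syndrome projectors as signs. -/
lemma pauliProj_eq_smul (B : Basis) {u u' : Fin 7 → ZMod 2} (v : Fin 7 → ZMod 2)
    (s : Fin 3 → ZMod 2) (h : nullCheck *ᵥ u = nullCheck *ᵥ u') :
    ∃ c : ℂ, ‖c‖ = 1 ∧ pauliProj B u v s = c • pauliProj B u' v s := by
  cases B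
  · have hw : nullCheck *ᵥ (u + u') = 0 := by
      rw [Matrix.mulVec_add, h]; exact funext fun i => CharTwo.add_self_eq_zero _
    have hu : u = u + u' + u' := by
      ext i; simp only [Pi.add_apply]; rw [add_assoc, CharTwo.add_self_eq_zero, add_zero]
    set w := u + u'
    -- The sign is the eigenvalue of the stabilizer `Z^w` on syndrome `s`, times the sign from
    -- commuting `Z^w` past `X^v`.
    refine ⟨sgn (w 0 * s 0 + (w 4 * s 1 + w 6 * s 2)) * sgn (w ⬝ᵥ v), by simp, ?_⟩
    ext y x
    simp only [pauliProj, Matrix.of_apply, Matrix.smul_apply, smul_eq_mul, syndromeProj_Z]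
    split_ifs with hs
    · have hdot : w ⬝ᵥ (y + v) = w 0 * s 0 + (w 4 * s 1 + w 6 * s 2) := by
        conv_lhs => rw [nullCheck_eq_zero hw]
        simp only [add_dotProduct, smul_dotProduct, smul_eq_mul, ← hs.2, Matrix.mulVec]
      rw [← hdot, hu, add_dotProduct, dotProduct_add, sgn_add, sgn_add]
      linear_combination -(sgn (w ⬝ᵥ y) * sgn (u' ⬝ᵥ y)) * sgn_mul_self (w ⬝ᵥ v)
    · simp
  · obtain ⟨b, rfl⟩ := exists_parityCheck_mulVec_eq s
    refine ⟨sgn (b ⬝ᵥ (u + u')), by simp, ?_⟩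
    ext y x
    simp only [pauliProj, Matrix.of_apply, Matrix.smul_apply, smul_eq_mul, syndromeProj_X,
      Matrix.mulVec_add, h]
    split_ifs
    · simp only [dotProduct_add, sgn_add]
      linear_combination -(8⁻¹ * sgn (v ⬝ᵥ y) * sgn (b ⬝ᵥ x) * sgn (b ⬝ᵥ y) * sgn (b ⬝ᵥ u)) *
        sgn_mul_self (b ⬝ᵥ u')
    · simp

lemma syndromeProj_conjTranspose (B : Basis) (s : Fin 3 → ZMod 2) :
    (syndromeProj B s)ᴴ = syndromeProj B s := by
  ext y x
  rw [Matrix.conjTranspose_apply]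
  cases B
  · simp only [syndromeProj_Z]
    by_cases h : y = x
    · subst h; split_ifs <;> simp
    · have h' : ¬x = y := fun e => h e.symm
      simp [h, h']
  · obtain ⟨b, rfl⟩ := exists_parityCheck_mulVec_eq s
    simp only [syndromeProj_X, add_comm y x]
    split_ifs
    · rw [star_mul', star_sgn]; simp
    · simp

/-- A circuit whose fault-free Kraus operators are the syndrome projectors of type `B` with a
normalization `κ`. -/
structure ExtractsSyndrome {m : ℕ} (B : Basis) (C : Circuit m)
    (R : Matrix (Fin 3) (Fin m) (ZMod 2)) (κ : ℂ) : Prop where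
  gates : ∀ g ∈ C.gates, g.1 ≠ g.2
  measAnc : ∀ j, C.measAnc j = B
  measFlag : C.measFlag = B.swap
  kraus : ∀ b f, C.kraus C.noFault b f = (if f = 0 then κ else 0) • syndromeProj B (R *ᵥ b)
  ne_zero : κ ≠ 0
  normalized : ∀ s, (∑ b : Fin m → ZMod 2, if R *ᵥ b = s then κ * star κ else 0) = 1

section

variable {m : ℕ} {B : Basis} {C : Circuit m} {R : Matrix (Fin 3) (Fin m) (ZMod 2)} {κ : ℂ}

/-- The phases cancel in `K ρ Kᴴ`, and the outcomes decoded to `s` have total weight 1 by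
`normalized`. The factor `t` will be the indicator of the flag outcome. -/
lemma ExtractsSyndrome.instrument (h : ExtractsSyndrome B C R κ) {F : C.Fault}
    {D : (Fin 3 → ZMod 2) → DataOp} {f : ZMod 2} {t : ℂ}
    (hK : ∀ b, ∃ c : ℂ, ‖c‖ = 1 ∧ C.kraus F b f = (c * (t * κ)) • D (R *ᵥ b))
    (s : Fin 3 → ZMod 2) (ρ : DataOp) :
    C.instrument R F s f ρ = (t * star t) • (D s * ρ * (D s)ᴴ) := by
  have e : ∀ b, (if R *ᵥ b = s then C.kraus F b f * ρ * (C.kraus F b f)ᴴ else 0) =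
      (if R *ᵥ b = s then κ * star κ else 0) • ((t * star t) • (D s * ρ * (D s)ᴴ)) := by
    intro b
    split_ifs with hb
    · obtain ⟨c, hc, hc'⟩ := hK b
      have hcc : c * star c = 1 := by
        rw [Complex.star_def, Complex.mul_conj, Complex.normSq_eq_norm_sq, hc]; simp
      rw [hc', hb, Matrix.conjTranspose_smul, Matrix.smul_mul, Matrix.smul_mul, Matrix.mul_smul,
        smul_smul, smul_smul]
      congr 1
      rw [star_mul', star_mul']
      linear_combination t * κ * star t * star κ * hcc
    · rw [zero_smul]
  rw [Circuit.instrument, Finset.sum_congr rfl fun b _ => e b, ← Finset.sum_smul, h.normalized,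
    one_smul]

lemma ExtractsSyndrome.measuresSyndrome (h : ExtractsSyndrome B C R κ) :
    MeasuresSyndrome B C R := by
  refine ⟨fun b => ?_, fun b => ⟨κ, h.ne_zero, ?_⟩, fun s ρ => ?_⟩
  · rw [h.kraus, if_neg one_ne_zero, zero_smul]
  · rw [h.kraus, if_pos rfl]
  · rw [h.instrument (D := syndromeProj B) (t := 1) fun b => ⟨1, by simp, by simp [h.kraus]⟩,
      syndromeProj_conjTranspose]
    simp

lemma ExtractsSyndrome.kraus_fault (h : ExtractsSyndrome B C R κ) (F : C.Fault)
    (b : Fin m → ZMod 2) (f : ZMod 2) :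
    ∃ c : ℂ, ‖c‖ = 1 ∧ C.kraus F b f =
      (c * ((if f + B.swap.flip (C.frame (Circuit.bits F)) .flag = 0 then 1 else 0) * κ)) •
        pauliProj B (fun i => B.swap.flip (C.frame (Circuit.bits F)) (.data i))
          (fun i => B.flip (C.frame (Circuit.bits F)) (.data i))
          (R *ᵥ b + R *ᵥ fun j => B.flip (C.frame (Circuit.bits F)) (.anc j)) := by
  obtain ⟨c, hc, hK⟩ := C.kraus_eq h.gates F b f
  set p := C.frame (Circuit.bits F)
  simp only [h.measAnc, h.measFlag, h.kraus, Matrix.mulVec_add, Matrix.smul_apply,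
    smul_eq_mul] at hK
  have hite : ∀ P : Prop, [Decidable P] → (if P then κ else 0) = (if P then 1 else 0) * κ := by
    intro P _; split_ifs <;> simp
  cases B
  · refine ⟨c * sgn ((fun i => p.2 (.data i)) ⬝ᵥ fun i => p.1 (.data i)) *
      sgn ((fun i => p.2 (.data i)) ⬝ᵥ fun i => p.1 (.data i)), by simp [hc], ?_⟩
    ext y x
    rw [hK, hite]
    simp only [Matrix.smul_apply, smul_eq_mul, pauliProj, Matrix.of_apply, Basis.swap, Basis.flip]
    rw [mul_assoc c, sgn_mul_self]
    ring
  · refine ⟨c, hc, ?_⟩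
    ext y x
    rw [hK, hite]
    simp only [Matrix.smul_apply, smul_eq_mul, pauliProj, Matrix.of_apply, Basis.swap, Basis.flip]
    ring

/-- The fault-free flag is always 0, so a flipped flag never reads 0. -/
lemma ExtractsSyndrome.detectable (h : ExtractsSyndrome B C R κ) {F : C.Fault}
    (hF : flagHom (C.effect B R (Circuit.bits F)) = 1) : C.Detectable F := by
  intro b
  obtain ⟨c, -, hK⟩ := h.kraus_fault F b 0
  have hflag : B.swap.flip (C.frame (Circuit.bits F)) .flag = 1 := hF
  rw [hK, hflag]
  simp

end

lemma effectOf_eq {m₁ m₂ : ℕ} {R₁ : Matrix (Fin 3) (Fin m₁) (ZMod 2)}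
    {R₂ : Matrix (Fin 3) (Fin m₂) (ZMod 2)} {u₁ v₁ : Wire m₁ → ZMod 2} {u₂ v₂ : Wire m₂ → ZMod 2}
    (h : effectOf R₁ u₁ v₁ = effectOf R₂ u₂ v₂) :
    (nullCheck *ᵥ fun i => u₁ (.data i)) = (nullCheck *ᵥ fun i => u₂ (.data i)) ∧
      (fun i => v₁ (.data i)) = (fun i => v₂ (.data i)) ∧
      (R₁ *ᵥ fun j => v₁ (.anc j)) = (R₂ *ᵥ fun j => v₂ (.anc j)) ∧ u₁ .flag = u₂ .flag := by
  refine ⟨funext fun i => ?_, funext fun i => ?_, funext fun i => ?_, ?_⟩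
  · simpa [effectOf] using congrFun h (Fin.castAdd 1 (Fin.castAdd 3 (Fin.castAdd 7 i)))
  · simpa [effectOf] using congrFun h (Fin.castAdd 1 (Fin.castAdd 3 (Fin.natAdd 4 i)))
  · simpa [effectOf] using congrFun h (Fin.castAdd 1 (Fin.natAdd 11 i))
  · exact congrArg flagHom h

/-- Faults with the same effect give circuits of the same behaviour. -/
lemma sameBehaviour {m₁ m₂ : ℕ} {B : Basis} {C₁ : Circuit m₁} {C₂ : Circuit m₂}
    {R₁ : Matrix (Fin 3) (Fin m₁) (ZMod 2)} {R₂ : Matrix (Fin 3) (Fin m₂) (ZMod 2)} {κ₁ κ₂ : ℂ}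
    (h₁ : ExtractsSyndrome B C₁ R₁ κ₁) (h₂ : ExtractsSyndrome B C₂ R₂ κ₂) {F₁ : C₁.Fault}
    {F₂ : C₂.Fault} (h : C₁.effect B R₁ (Circuit.bits F₁) = C₂.effect B R₂ (Circuit.bits F₂)) :
    SameBehaviour C₁ R₁ F₁ C₂ R₂ F₂ := by
  obtain ⟨hu, hv, hs, hf⟩ := effectOf_eq h
  have hK₁ := h₁.kraus_fault F₁
  have hK₂ := h₂.kraus_fault F₂
  rw [hv, hs, hf] at hK₁
  set u₁ := fun i => B.swap.flip (C₁.frame (Circuit.bits F₁)) (.data i)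
  set u₂ := fun i => B.swap.flip (C₂.frame (Circuit.bits F₂)) (.data i)
  set v := fun i => B.flip (C₂.frame (Circuit.bits F₂)) (.data i)
  set σ := R₂ *ᵥ fun j => B.flip (C₂.frame (Circuit.bits F₂)) (.anc j)
  set φ := B.swap.flip (C₂.frame (Circuit.bits F₂)) .flag
  -- The type-`B` parts `u₁` and `u₂` differ by a stabilizer, which the projector absorbs into the
  -- phase.
  have hK₁' : ∀ b f, ∃ c : ℂ, ‖c‖ = 1 ∧ C₁.kraus F₁ b f =
      (c * ((if f + φ = 0 then 1 else 0) * κ₁)) • pauliProj B u₂ v (R₁ *ᵥ b + σ) := by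
    intro b f
    obtain ⟨c, hc, e⟩ := hK₁ b f
    obtain ⟨c', hc', e'⟩ := pauliProj_eq_smul B v (R₁ *ᵥ b + σ) hu
    refine ⟨c * c', by simp [hc, hc'], ?_⟩
    rw [e, e', smul_smul]
    congr 1; ring
  refine ⟨fun b₁ b₂ f hb => ?_, fun s f ρ => ?_⟩
  · obtain ⟨c₁, hc₁, e₁⟩ := hK₁' b₁ f
    obtain ⟨c₂, hc₂, e₂⟩ := hK₂ b₂ f
    have hn₁ : c₁ ≠ 0 := fun h => by simp [h] at hc₁
    have hn₂ : c₂ ≠ 0 := fun h => by simp [h] at hc₂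
    -- The flag indicator is common to both sides, so the ratio of the remaining scalars works even
    -- when both operators vanish.
    refine ⟨c₁ * κ₁ / (c₂ * κ₂), div_ne_zero (mul_ne_zero hn₁ h₁.ne_zero)
      (mul_ne_zero hn₂ h₂.ne_zero), ?_⟩
    rw [e₁, e₂, hb, smul_smul]
    congr 1
    have := h₂.ne_zero
    field_simp
  · rw [h₁.instrument (D := fun s => pauliProj B u₂ v (s + σ)) fun b => hK₁' b f,
      h₂.instrument (D := fun s => pauliProj B u₂ v (s + σ)) fun b => hK₂ b f]

/-! ### The two circuits, fault bounds in both directions, and ranks. -/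

lemma steane_extractsSyndrome (B : Basis) :
    ExtractsSyndrome B (steaneStyle B) parityCheck 4⁻¹ where
  gates := by cases B <;> decide +kernel
  measAnc := by cases B <;> exact fun _ => rfl
  measFlag := by cases B <;> rfl
  kraus := by
    cases B
    · exact kraus_steaneStyleZ
    · exact kraus_steaneStyleX
  ne_zero := by norm_num
  normalized s := by
    -- Each syndrome comes from a coset of the four-dimensional kernel: `16 * (1/4)^2 = 1`.
    have h : ∀ s : Fin 3 → ZMod 2,
        (Finset.univ.filter fun b : Fin 7 → ZMod 2 => parityCheck *ᵥ b = s).card = 16 := by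
      decide +kernel
    rw [← Finset.sum_filter, Finset.sum_const, h]
    norm_num

lemma optimized_extractsSyndrome (B : Basis) :
    ExtractsSyndrome B (optimized B) effectiveCheck 1 where
  gates := by cases B <;> decide +kernel
  measAnc := by cases B <;> exact fun _ => rfl
  measFlag := by cases B <;> rfl
  kraus := by
    cases B
    · exact kraus_optimizedZ
    · exact kraus_optimizedX
  ne_zero := one_ne_zero
  normalized s := by
    have h : ∀ s : Fin 3 → ZMod 2,
        (Finset.univ.filter fun b : Fin 3 → ZMod 2 => effectiveCheck *ᵥ b = s).card = 1 := by
      decide +kernel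
    rw [← Finset.sum_filter, Finset.sum_const, h]
    norm_num

lemma faultBounded_steane_optimized (B : Basis) :
    FaultBounded (steaneStyle B) parityCheck (optimized B) effectiveCheck := by
  intro F
  rcases eq_zero_or_eq_one (flagHom ((steaneStyle B).effect B parityCheck (Circuit.bits F)))
    with hF | hF
  · obtain ⟨F', hw, he⟩ := exists_fault _ _ B _ _ _ _ (effect_single_steane B)
      (effect_single_optimized B) (List.subset_append_left _ _)
      (mem_steane B) (exists_optimized B) pairsCovered_steane_optimized F hF
    exact .inr ⟨F', hw, sameBehaviour (steane_extractsSyndrome B) (optimized_extractsSyndrome B)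
      he.symm⟩
  · exact .inl ((steane_extractsSyndrome B).detectable hF)

lemma faultBounded_optimized_steane (B : Basis) :
    FaultBounded (optimized B) effectiveCheck (steaneStyle B) parityCheck := by
  intro F
  rcases eq_zero_or_eq_one (flagHom ((optimized B).effect B effectiveCheck (Circuit.bits F)))
    with hF | hF
  · obtain ⟨F', hw, he⟩ := exists_fault _ _ B _ _ _ _ (effect_single_optimized B)
      (effect_single_steane B) (List.subset_append_right _ _)
      (mem_optimized B) (exists_steane B) pairsCovered_optimized_steane F hF
    exact .inr ⟨F', hw, sameBehaviour (optimized_extractsSyndrome B) (steane_extractsSyndrome B)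
      he.symm⟩
  · exact .inl ((optimized_extractsSyndrome B).detectable hF)

lemma rank_eq_three {n : ℕ} {A : Matrix (Fin 3) (Fin n) (ZMod 2)}
    {A' : Matrix (Fin n) (Fin 3) (ZMod 2)} (h : A * A' = 1) : A.rank = 3 := by
  refine le_antisymm (by simpa using A.rank_le_card_height) ?_
  have := Matrix.rank_mul_le_left A A'
  rwa [h, Matrix.rank_one, Fintype.card_fin] at this

end SteaneSE

theorem mainTheorem1 :
    (∀ B : SteaneSE.Basis,
      SteaneSE.FaultEquivalent
        (SteaneSE.steaneStyle B) SteaneSE.parityCheck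
        (SteaneSE.optimized B) SteaneSE.effectiveCheck ∧
      SteaneSE.MeasuresSyndrome B (SteaneSE.steaneStyle B) SteaneSE.parityCheck ∧
      SteaneSE.MeasuresSyndrome B (SteaneSE.optimized B) SteaneSE.effectiveCheck ∧
      (SteaneSE.optimized B).gates.length = 14 ∧
      (SteaneSE.optimized B).numAncillas = 4) ∧
    SteaneSE.effectiveCheck = SteaneSE.parityCheck.submatrix id ![1, 2, 4] ∧
    SteaneSE.parityCheck.rank = 3 ∧
    SteaneSE.effectiveCheck.rank = 3 := by
  refine ⟨fun B => ⟨⟨SteaneSE.faultBounded_steane_optimized B,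
    SteaneSE.faultBounded_optimized_steane B⟩,
    (SteaneSE.steane_extractsSyndrome B).measuresSyndrome,
    (SteaneSE.optimized_extractsSyndrome B).measuresSyndrome, by cases B <;> rfl, rfl⟩,
    by decide +kernel, ?_, ?_⟩
  -- This right inverse selects the unit columns 0, 4 and 6 of `parityCheck`; the next one is the
  -- inverse of `effectiveCheck`.
  · exact SteaneSE.rank_eq_three
      (A' := !![1, 0, 0; 0, 0, 0; 0, 0, 0; 0, 0, 0; 0, 1, 0; 0, 0, 0; 0, 0, 1]) (by decide +kernel)
  · exact SteaneSE.rank_eq_three (A' := !![1, 0, 1; 0, 0, 1; 1, 1, 0]) (by decide +kernel)
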